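/- Let $d\ge 1$ be an integer and let $\alpha,\beta\in\mathbb R$ satisfy $\tfrac12<\alpha<\tfrac{d+1}{2}$, $\beta>0$ and $\alpha+\beta>\tfrac d2$. All functions are complex-valued on $\mathbb R^d$, and $\|\cdot\|_2$ is the norm of $L^2=L^2(\mathbb R^d)$. For $1\le p<\infty$, $L^{p,\infty}$ is the Lorentz space of measurable $f$ with $\|f\|_{L^{p,\infty}}=\sup_{t>0}t^{1/p}f^*(t)<\infty$, where $f^*(t)=\inf\{s>0:|\{x:|f(x)|>s\}|\le t\}$. Let $\mathscr S_0$ be the set of Schwartz functions $\phi$ such that $\hat\phi$ and all its derivatives vanish at $0$, where $\hat\phi(\xi)=\int e^{-2\pi i x\cdot\xi}\phi(x)\,dx$, and let $\Lambda^s\phi=((2\pi|\cdot|)^s\hat\phi)^\vee$ for $\phi\in\mathscr S_0$. On the dual $\mathscr S_0'$, $\Lambda^s$ is defined by $\langle\Lambda^s u,\phi\rangle=\langle u,\Lambda^s\phi\rangle$. The homogeneous Sobolev space is $\dot H^s=\{u\in\mathscr S_0':\Lambda^s u\in L^2\}$ with $\|u\|_{\dot H^s}=\|\Lambda^s u\|_2$.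 The inhomogeneous Sobolev space $H^s$ is the set of tempered distributions $u$ with $(1+4\pi^2|\cdot|^2)^{s/2}\hat u\in L^2$. A function $f$ acts as a distribution by $\langle f,\phi\rangle=\int f\phi\,dx$. Then there exist $\theta_1,\theta_2\in(0,1)$ and a constant $C<\infty$ such that $$\|fg\|_2\le C\,\|f\|_{L^{d/(d+1-2\alpha),\infty}}^{1-\theta_1}\,\|f\|_{\dot H^\alpha}^{\theta_1}\,\|g\|_2^{1-\theta_2}\,\|g\|_{\dot H^\beta}^{\theta_2}$$ for all $f\in L^{d/(d+1-2\alpha),\infty}\cap\dot H^\alpha$ and all $g\in H^\beta$. Moreover, for every $\mu\in[0,1]$ with $\alpha+(1-\mu)\beta\ge \tfrac d2+1$, there exist $\theta_1,\theta_2\in(0,1)$ satisfying $$(1+\mu)\theta_1+\theta_2+\frac1\beta\le 2$$ for which the displayed estimate holds, with some constant $C<\infty$, for all such $f$ and $g$. -/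

import Mathlib

open MeasureTheory FourierTransform
open scoped ENNReal NNReal SchwartzMap

noncomputable section

/-- The Euclidean space `ℝᵈ`. -/
abbrev Eu (d : ℕ) : Type := EuclideanSpace ℝ (Fin d)

/-- The distribution function `d_f(s) = |{x : |f(x)| > s}|` (Lebesgue measure). -/
def distribFun {d : ℕ} (f : Eu d → ℂ) (s : ℝ≥0) : ℝ≥0∞ :=
  volume {x : Eu d | (s : ℝ) < ‖f x‖}

/-- The decreasing rearrangement `f*(t) = inf {s > 0 : d_f(s) ≤ t}` (with `inf ∅ = ∞`). -/
def decRearrangement {d : ℕ} (f : Eu d → ℂ) (t : ℝ) : ℝ≥0∞ :=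
  ⨅ (s : ℝ≥0) (_ : 0 < s) (_ : distribFun f s ≤ ENNReal.ofReal t), (s : ℝ≥0∞)

/-- The Lorentz quasi-norm `‖f‖_{p,∞} = sup_{t > 0} t^{1/p} f*(t)`. -/
def weakLpNorm {d : ℕ} (p : ℝ) (f : Eu d → ℂ) : ℝ≥0∞ :=
  ⨆ (t : ℝ) (_ : 0 < t), ENNReal.ofReal t ^ (1 / p) * decRearrangement f t

/-- Membership in the Lorentz space `L^{p,∞}(ℝᵈ)`. -/
def MemWeakLp {d : ℕ} (p : ℝ) (f : Eu d → ℂ) : Prop :=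
  AEStronglyMeasurable f volume ∧ weakLpNorm p f < ∞

/-- The space `𝒮₀` of Schwartz functions whose Fourier transform vanishes at the origin together
with all its derivatives. -/
def SchwartzZero (d : ℕ) : Set 𝓢(Eu d, ℂ) :=
  {φ | ∀ n : ℕ, iteratedFDeriv ℝ n (⇑(𝓕 φ : 𝓢(Eu d, ℂ))) 0 = 0}

/-- The fractional Laplacian `Λˢ φ = ((2π|·|)ˢ φ̂)^∨` of a test function; it is applied to
`φ ∈ 𝒮₀` only. The Fourier transform is `φ̂(ξ) = ∫ e^{-2πi x·ξ} φ(x) dx`. -/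
def fracLaplacian {d : ℕ} (s : ℝ) (φ : 𝓢(Eu d, ℂ)) : Eu d → ℂ :=
  𝓕⁻ (fun ξ : Eu d => (((2 * Real.pi * ‖ξ‖) ^ s : ℝ) : ℂ) * (𝓕 φ : 𝓢(Eu d, ℂ)) ξ)

/-- `Λˢ f = h` in `𝒮₀'`, for functions `f` and `h` regarded as elements of `𝒮₀'` through the
pairing `⟨f, φ⟩ = ∫ f φ`: that is, `⟨f, Λˢ φ⟩ = ⟨h, φ⟩` for all `φ ∈ 𝒮₀`. -/
def IsFracLaplacian {d : ℕ} (s : ℝ) (f h : Eu d → ℂ) : Prop :=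
  ∀ φ ∈ SchwartzZero d,
    Integrable (fun x => f x * fracLaplacian s φ x) ∧ Integrable (fun x => h x * φ x) ∧
      ∫ x, f x * fracLaplacian s φ x = ∫ x, h x * φ x

/-- `f` belongs to the homogeneous Sobolev space `Ḣˢ(ℝᵈ)`, that is, `Λˢ f ∈ L²`. -/
def MemHomSobolev {d : ℕ} (s : ℝ) (f : Eu d → ℂ) : Prop :=
  ∃ h : Eu d → ℂ, MemLp h 2 volume ∧ IsFracLaplacian s f h

/-- The norm `‖f‖_{Ḣˢ} = ‖Λˢ f‖₂`. As `Λˢ f` is unique up to null sets, the infimum runs over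
representatives of a single class in `L²`; it is `∞` when `f ∉ Ḣˢ`. -/
def homSobolevNorm {d : ℕ} (s : ℝ) (f : Eu d → ℂ) : ℝ≥0∞ :=
  ⨅ (h : Eu d → ℂ) (_ : MemLp h 2 volume) (_ : IsFracLaplacian s f h), eLpNorm h 2 volume

/-- The function `g` belongs to the inhomogeneous Sobolev space `Hˢ(ℝᵈ)`: the tempered
distribution `φ ↦ ∫ φ g` that it defines is in Mathlib's Bessel potential space of order `s` and
exponent `2`. -/
def MemInhomSobolev {d : ℕ} (s : ℝ) (g : Eu d → ℂ) : Prop :=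
  AEStronglyMeasurable g volume ∧
    ∃ u : 𝓢'(Eu d, ℂ), TemperedDistribution.MemSobolev s 2 u ∧
      ∀ φ : 𝓢(Eu d, ℂ), Integrable (fun x => φ x * g x) ∧ u φ = ∫ x, φ x * g x

/-- The estimate
`‖fg‖₂ ≤ C ‖f‖_{d/(d+1-2α),∞}^{1-θ₁} ‖f‖_{Ḣ^α}^{θ₁} ‖g‖₂^{1-θ₂} ‖g‖_{Ḣ^β}^{θ₂}`
for all `f ∈ L^{d/(d+1-2α),∞} ∩ Ḣ^α` and `g ∈ H^β`, with one finite constant `C`. -/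
def ProductEstimate (d : ℕ) (α β θ₁ θ₂ : ℝ) : Prop :=
  ∃ C : ℝ≥0, ∀ f g : Eu d → ℂ,
    MemWeakLp (d / (d + 1 - 2 * α)) f → MemHomSobolev α f → MemInhomSobolev β g →
      eLpNorm (fun x => f x * g x) 2 volume ≤
        C * weakLpNorm (d / (d + 1 - 2 * α)) f ^ (1 - θ₁) * homSobolevNorm α f ^ θ₁ *
          eLpNorm g 2 volume ^ (1 - θ₂) * homSobolevNorm β g ^ θ₂

end

/-! Hölder's inequality with `1/q + 1/r = 1/2` splits the product, and one Gagliardo–Nirenberg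
inequality with a weak endpoint, `‖f‖_q ≤ C ‖f‖_{p,∞}^{1-θ} ‖f‖_{Ḣˢ}^θ` for `1 < p < q` and `d/2 - s
< d/q`, bounds both factors. For `f` it is used with `p = d/(d+1-2α)` and `s = α`, where `p > 1` is
exactly `α > 1/2`; for `g` with `p = 2` and `s = β`, the weak bound being Chebyshev's inequality.
The only freedom is `x = d/q`, which fixes `θ₁` and `θ₂` by scaling (`productEstimate_of_scaling`).

For the Gagliardo–Nirenberg inequality let `A` bound the weak norm and `B` the Sobolev norm, and cut
frequencies at `R` and `R * L`. The part below `R` is `f` integrated against a kernel of scale `R`,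
hence `O(A R^{d/p})`. The part between has integrable Fourier transform by Cauchy–Schwarz, hence is
`O(B L^y R^{d/2-s})` as soon as `s + y > d/2`. The part above has `L²` norm at most `(R L)^{-s} B`.
So at a level `t` dominating the two bounded parts, Chebyshev's inequality controls the distribution
function (`exists_meas_lt_norm_le`).

Choose `R` with `A R^{d/p} = B R^{d/2-s}`, and call the common value `N`. Below a multiple of `N`
the weak bound gives decay `t^{-p}`; above it, letting `L` grow with `t` gives decay `t^{-b}` with
`b > q`. The layer-cake formula then gives the `L^q` bound (`exists_eLpNorm_le_of_pos`).

As `Λˢ f` is known only on `𝒮₀`, low frequencies cannot be recovered from it. They are taken from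
`f` itself, and `Λˢ f` is tested only on functions whose Fourier transform vanishes near the origin
(`ae_eq_low_add_high`). -/

/-! ### Layer-cake integration and weak Lebesgue bounds. -/

/-- Integral of the power `t ^ (q - 1 - c)` against a normalised power weight near the origin. -/
lemma lintegral_Ioc_const_mul_rpow {c q K N : ℝ} (hcq : c < q) (hK : 0 ≤ K) (hN : 0 < N) :
    ∫⁻ t in Set.Ioc 0 N, ENNReal.ofReal (K * (t / N) ^ (-c)) * ENNReal.ofReal (t ^ (q - 1)) =
      ENNReal.ofReal (K * N ^ q / (q - c)) := by
  have key : ∀ t ∈ Set.Ioc 0 N, ENNReal.ofReal (K * (t / N) ^ (-c)) * ENNReal.ofReal (t ^ (q - 1))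
      = ENNReal.ofReal (K * N ^ c * t ^ (q - 1 - c)) := by
    intro t ht
    have h0 : 0 < t := ht.1
    rw [← ENNReal.ofReal_mul (by positivity)]
    congr 1
    rw [Real.div_rpow h0.le hN.le, Real.rpow_neg hN.le, div_inv_eq_mul, sub_eq_add_neg (q - 1) c,
      Real.rpow_add h0]
    ring
  rw [setLIntegral_congr_fun measurableSet_Ioc key]
  have hint : IntegrableOn (fun t : ℝ => K * N ^ c * t ^ (q - 1 - c)) (Set.Ioc 0 N) :=
    ((intervalIntegral.intervalIntegrable_rpow' (by linarith)).1).const_mul _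
  rw [← ofReal_integral_eq_lintegral_ofReal hint]
  · congr 1
    rw [integral_const_mul, ← intervalIntegral.integral_of_le hN.le,
      integral_rpow (Or.inl (by linarith)), Real.zero_rpow (by linarith),
      show q - 1 - c + 1 = q - c by ring, sub_zero, mul_assoc, ← mul_div_assoc, mul_div_assoc K,
      ← Real.rpow_add hN]
    ring_nf
  · filter_upwards [ae_restrict_mem measurableSet_Ioc] with t ht
    have h0 : 0 < t := ht.1
    simp only [Pi.zero_apply]
    positivity

lemma lintegral_Ioi_const_mul_rpow {c q K N : ℝ} (hcq : q < c) (hK : 0 ≤ K) (hN : 0 < N) :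
    ∫⁻ t in Set.Ioi N, ENNReal.ofReal (K * (t / N) ^ (-c)) * ENNReal.ofReal (t ^ (q - 1)) =
      ENNReal.ofReal (K * N ^ q / (c - q)) := by
  have key : ∀ t ∈ Set.Ioi N, ENNReal.ofReal (K * (t / N) ^ (-c)) * ENNReal.ofReal (t ^ (q - 1))
      = ENNReal.ofReal (K * N ^ c * t ^ (q - 1 - c)) := by
    intro t ht
    have h0 : 0 < t := hN.trans ht
    rw [← ENNReal.ofReal_mul (by positivity)]
    congr 1
    rw [Real.div_rpow h0.le hN.le, Real.rpow_neg hN.le, div_inv_eq_mul, sub_eq_add_neg (q - 1) c,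
      Real.rpow_add h0]
    ring
  rw [setLIntegral_congr_fun measurableSet_Ioi key]
  have hint : IntegrableOn (fun t : ℝ => K * N ^ c * t ^ (q - 1 - c)) (Set.Ioi N) :=
    (integrableOn_Ioi_rpow_of_lt (by linarith) hN).const_mul _
  rw [← ofReal_integral_eq_lintegral_ofReal hint]
  · congr 1
    rw [integral_const_mul, integral_Ioi_rpow_of_lt (by linarith) hN,
      show q - 1 - c + 1 = q - c by ring, mul_assoc, ← neg_div_neg_eq, neg_neg, ← mul_div_assoc,
      ← Real.rpow_add hN]
    ring_nf
  · filter_upwards [ae_restrict_mem measurableSet_Ioi] with t ht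
    have h0 : 0 < t := hN.trans ht
    simp only [Pi.zero_apply]
    positivity

/-- Marcinkiewicz-type interpolation: a function whose distribution function is dominated by
`(t / N) ^ (-a)` for small `t` and by `(t / N) ^ (-b)` for large `t` is in `L^q`, `a < q < b`. -/
lemma lintegral_rpow_le_of_meas_le {X : Type*} [MeasurableSpace X] {μ : Measure X} {u : X → ℝ}
    (hu0 : ∀ x, 0 ≤ u x) (hu : AEMeasurable u μ) {a b q K N : ℝ} (hq : 0 < q) (haq : a < q)
    (hqb : q < b) (hK : 0 ≤ K) (hN : 0 < N)
    (ha : ∀ t, 0 < t → t ≤ N → μ {x | t < u x} ≤ ENNReal.ofReal (K * (t / N) ^ (-a)))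
    (hb : ∀ t, N < t → μ {x | t < u x} ≤ ENNReal.ofReal (K * (t / N) ^ (-b))) :
    ∫⁻ x, ENNReal.ofReal (u x ^ q) ∂μ ≤
      ENNReal.ofReal (q * (1 / (q - a) + 1 / (b - q)) * K * N ^ q) := by
  rw [lintegral_rpow_eq_lintegral_meas_lt_mul μ (.of_forall hu0) hu hq,
    ← Set.Ioc_union_Ioi_eq_Ioi hN.le,
    lintegral_union measurableSet_Ioi (Set.Ioc_disjoint_Ioi le_rfl)]
  have h1 : 0 < q - a := by linarith
  have h2 : 0 < b - q := by linarith
  calc _ ≤ ENNReal.ofReal q * (ENNReal.ofReal (K * N ^ q / (q - a)) +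
        ENNReal.ofReal (K * N ^ q / (b - q))) := by
        rw [← lintegral_Ioc_const_mul_rpow haq hK hN, ← lintegral_Ioi_const_mul_rpow hqb hK hN]
        refine mul_le_mul' le_rfl (add_le_add ?_ ?_)
        · refine setLIntegral_mono' measurableSet_Ioc fun t ht => ?_
          gcongr
          exact ha t ht.1 ht.2
        · refine setLIntegral_mono' measurableSet_Ioi fun t ht => ?_
          gcongr
          exact hb t ht
    _ = _ := by
        rw [← ENNReal.ofReal_add (by positivity) (by positivity), ← ENNReal.ofReal_mul hq.le]
        congr 1
        ring

/-- The part of a weak `L^p` function above the level `s` is integrable. -/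
lemma lintegral_indicator_lt_norm_le {X : Type*} [MeasurableSpace X] {μ : Measure X} {f : X → ℂ}
    (hf : AEStronglyMeasurable f μ) {p A s : ℝ} (hp : 1 < p) (hA : 0 < A) (hs : 0 < s)
    (h : ∀ t, 0 < t → μ {x | t < ‖f x‖} ≤ ENNReal.ofReal ((A / t) ^ p)) :
    ∫⁻ x, {x | s < ‖f x‖}.indicator (fun x => ‖f x‖ₑ) x ∂μ ≤
      ENNReal.ofReal (p / (p - 1) * (A / s) ^ p * s) := by
  set u : X → ℝ := {x | s < ‖f x‖}.indicator (fun x => ‖f x‖) with hu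
  have hmeas : NullMeasurableSet {x | s < ‖f x‖} μ :=
    nullMeasurableSet_lt aemeasurable_const hf.norm.aemeasurable
  -- Below level `s` the distribution function of the truncation is at most its value at `s`, whence
  -- `a = 0`; above `s` it decays like that of `f`.
  have key := lintegral_rpow_le_of_meas_le (μ := μ) (u := u) (a := 0) (b := p) (q := 1)
    (K := (A / s) ^ p) (N := s) (fun x => Set.indicator_nonneg (fun _ _ => norm_nonneg _) x)
    (hf.norm.aemeasurable.indicator₀ hmeas) one_pos one_pos hp (by positivity) hs ?_ ?_
  · have hp' : p - 1 ≠ 0 := by linarith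
    convert key using 2
    · ext x
      rw [Real.rpow_one, hu]
      by_cases hx : x ∈ {x | s < ‖f x‖}
      · simp only [Set.indicator_of_mem hx, ofReal_norm]
      · simp only [Set.indicator_of_notMem hx, ENNReal.ofReal_zero]
    · rw [Real.rpow_one]
      field_simp
      ring
  · intro t ht hts
    rw [neg_zero, Real.rpow_zero, mul_one]
    refine (measure_mono fun x hx => ?_).trans (h s hs)
    by_contra hx'
    rw [Set.mem_ofPred_eq, hu, Set.indicator_of_notMem hx'] at hx
    exact absurd ht hx.not_gt
  · intro t ht
    have ht0 : 0 < t := hs.trans ht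
    have : (A / s) ^ p * (t / s) ^ (-p) = (A / t) ^ p := by
      rw [Real.rpow_neg (by positivity), ← Real.inv_rpow (by positivity),
        ← Real.mul_rpow (by positivity) (by positivity)]
      congr 1
      field_simp
    rw [this]
    refine (measure_mono fun x hx => ?_).trans (h t ht0)
    rw [Set.mem_ofPred_eq, hu] at hx
    exact hx.trans_le (Set.indicator_le_self' (fun _ _ => norm_nonneg _) x)

/-- A weak `L^p` function integrated against a kernel at frequency scale `R`. -/
lemma lintegral_weakLp_mul_kernel_le {d : ℕ} {f k : Eu d → ℂ} (hf : AEStronglyMeasurable f)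
    {p A R K₁ K₂ : ℝ} (hp : 1 < p) (hA : 0 < A) (hR : 0 < R) (hK₁ : 0 ≤ K₁) (hK₂ : 0 ≤ K₂)
    (h : ∀ t, 0 < t → volume {x | t < ‖f x‖} ≤ ENNReal.ofReal ((A / t) ^ p))
    (hk₁ : ∫⁻ x, ‖k x‖ₑ ≤ ENNReal.ofReal K₁) (hk₂ : ∀ x, ‖k x‖ ≤ K₂ * R ^ d) (y : Eu d) :
    ∫⁻ x, ‖f x‖ₑ * ‖k (x - y)‖ₑ ≤
      ENNReal.ofReal ((K₁ + K₂ * (p / (p - 1))) * (A * R ^ (d / p))) := by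
  -- At this level `{s < ‖f‖}` has measure at most `R^{-d}`, which offsets the sup bound `K₂ R^d` of
  -- the kernel, so the two parts of `f` contribute the same order.
  set s : ℝ := A * R ^ (d / p) with hs_def
  have hs : 0 < s := by positivity
  have hmeas : NullMeasurableSet {x | s < ‖f x‖} volume :=
    nullMeasurableSet_lt aemeasurable_const hf.norm.aemeasurable
  have hp' : 0 < p - 1 := by linarith
  calc ∫⁻ x, ‖f x‖ₑ * ‖k (x - y)‖ₑ
      ≤ ∫⁻ x, ENNReal.ofReal s * ‖k (x - y)‖ₑ +
          ENNReal.ofReal (K₂ * R ^ d) * {x | s < ‖f x‖}.indicator (fun x => ‖f x‖ₑ) x := by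
        refine lintegral_mono fun x => ?_
        by_cases hx : s < ‖f x‖
        · rw [Set.indicator_of_mem (by exact hx), mul_comm]
          refine le_add_left ?_
          gcongr
          rw [← ofReal_norm]
          exact ENNReal.ofReal_le_ofReal (hk₂ _)
        · refine le_add_right ?_
          gcongr
          rw [← ofReal_norm]
          exact ENNReal.ofReal_le_ofReal (not_lt.1 hx)
    _ ≤ ENNReal.ofReal s * ENNReal.ofReal K₁ +
          ENNReal.ofReal (K₂ * R ^ d) * ENNReal.ofReal (p / (p - 1) * (A / s) ^ p * s) := by
        rw [lintegral_add_right' _ ((hf.enorm.indicator₀ hmeas).const_mul _),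
          lintegral_const_mul' _ _ ENNReal.ofReal_ne_top,
          lintegral_const_mul' _ _ ENNReal.ofReal_ne_top]
        gcongr
        · rw [lintegral_sub_right_eq_self (fun x => ‖k x‖ₑ) y]
          exact hk₁
        · exact lintegral_indicator_lt_norm_le hf hp hA hs h
    _ = _ := by
        rw [← ENNReal.ofReal_mul hs.le, ← ENNReal.ofReal_mul (by positivity),
          ← ENNReal.ofReal_add (by positivity) (by positivity)]
        congr 1
        have : (A / s) ^ p = (R ^ d)⁻¹ := by
          rw [hs_def, div_mul_cancel_left₀ hA.ne', ← Real.rpow_neg hR.le, ← Real.rpow_mul hR.le,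
            neg_mul, div_mul_cancel₀ _ (by linarith), Real.rpow_neg hR.le, Real.rpow_natCast]
        rw [this]
        field_simp

/-! ### Frequency cut-offs and their symbols. -/

/-- Real powers of a function of temperate growth that is bounded below have temperate growth. -/
lemma Function.HasTemperateGrowth.rpow_const_of_half_lt {H : Type*} [NormedAddCommGroup H]
    [NormedSpace ℝ H] {g : H → ℝ} (hg : g.HasTemperateGrowth) (hlt : ∀ x, 1 / 2 < g x) (r : ℝ) :
    (fun x => g x ^ r).HasTemperateGrowth := by
  set t := {y : ℝ | 1 / 2 < y}
  have ht : Set.range g ⊆ t := by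
    rintro - ⟨y, rfl⟩
    exact hlt y
  have hpos : ∀ x ∈ t, (0 : ℝ) < x := fun x hx => lt_trans (by norm_num) (show 1 / 2 < x from hx)
  have hdiff : ContDiffOn ℝ (⊤ : ℕ∞) (fun x : ℝ => x ^ r) t :=
    contDiffOn_fun_id.rpow_const_of_ne fun x hx => (hpos x hx).ne'
  have hunique : UniqueDiffOn ℝ t := (isOpen_lt' (1 / 2)).uniqueDiffOn
  refine hg.comp' ht hunique hdiff fun N => ?_
  obtain ⟨k, hk⟩ := exists_nat_ge r
  -- The `j`-th derivative of `x^r` is a Pochhammer factor times `x^(r-j)`. The power is at most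
  -- `(1+x)^k` if `j ≤ r` and at most `2^(j-r)` otherwise, since `x > 1/2`.
  set C : ℝ := ∑ j ∈ Finset.range (N + 1),
    ‖Polynomial.eval r (descPochhammer ℝ j)‖ * (1 + 2 ^ (j - r))
  refine ⟨k, C, by positivity, fun n hn x hx => ?_⟩
  have hx0 := hpos x hx
  have hcd : ContDiffAt ℝ n (fun x : ℝ => x ^ r) x :=
    Real.contDiffAt_rpow_const <| Or.inl hx0.ne'
  rw [norm_iteratedFDerivWithin_eq_norm_iteratedDerivWithin,
    iteratedDerivWithin_eq_iteratedDeriv hunique hcd hx, iteratedDeriv_eq_iterate,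
    Real.iter_deriv_rpow_const, norm_mul]
  have hterm : ‖Polynomial.eval r (descPochhammer ℝ n)‖ * (1 + 2 ^ (n - r)) ≤ C :=
    Finset.single_le_sum (f := fun j : ℕ =>
      ‖Polynomial.eval r (descPochhammer ℝ j)‖ * (1 + 2 ^ (j - r))) (fun _ _ => by positivity)
      (Finset.mem_range.2 (Nat.lt_succ_of_le hn))
  have hone : 1 ≤ 1 + ‖x‖ := by simp
  have hpow : ‖x ^ (r - n)‖ ≤ (1 + 2 ^ (n - r)) * (1 + ‖x‖) ^ k := by
    rw [Real.norm_of_nonneg (Real.rpow_nonneg hx0.le _)]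
    have hk1 : 1 ≤ (1 + ‖x‖) ^ k := one_le_pow₀ hone
    have h2 : (0 : ℝ) < 2 ^ (n - r) := by positivity
    rcases le_or_gt 0 (r - n) with h | h
    · have : x ^ (r - n) ≤ (1 + ‖x‖) ^ k := by
        rw [← Real.rpow_natCast]
        refine (Real.rpow_le_rpow hx0.le ?_ h).trans (Real.rpow_le_rpow_of_exponent_le hone ?_)
        · rw [Real.norm_of_nonneg hx0.le]; linarith
        · exact (sub_le_self _ (Nat.cast_nonneg n)).trans hk
      nlinarith
    · have : x ^ (r - n) ≤ 2 ^ (n - r) := by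
        have := Real.rpow_le_rpow_of_nonpos (by norm_num : (0 : ℝ) < 1 / 2)
          (show 1 / 2 < x from hx).le h.le
        rwa [one_div, Real.inv_rpow (by norm_num), ← Real.rpow_neg (by norm_num), neg_sub] at this
      nlinarith
  calc _ ≤ ‖Polynomial.eval r (descPochhammer ℝ n)‖ * ((1 + 2 ^ (n - r)) * (1 + ‖x‖) ^ k) := by
        gcongr
    _ ≤ _ := by
        rw [← mul_assoc]
        gcongr

section Cutoff

variable {d : ℕ}

/-- A smooth cut-off function, equal to `1` on the unit ball and vanishing outside the ball of
radius `2`. -/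
noncomputable def cutoffBump (d : ℕ) : ContDiffBump (0 : Eu d) :=
  ⟨1, 2, one_pos, one_lt_two⟩

/-- The cut-off function at frequency scale `R`. -/
noncomputable def lowSymbol (R : ℝ) (ξ : Eu d) : ℝ := cutoffBump d (R⁻¹ • ξ)

/-- The symbol `(2π|ξ|)^{-s}` cut off to high frequencies. -/
noncomputable def highSymbol (s R : ℝ) (ξ : Eu d) : ℝ :=
  (1 - lowSymbol R ξ) * (2 * Real.pi * ‖ξ‖) ^ (-s)

lemma contDiff_lowSymbol (R : ℝ) : ContDiff ℝ (⊤ : ℕ∞) (lowSymbol (d := d) R) :=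
  (cutoffBump d).contDiff.comp (contDiff_const_smul R⁻¹)

lemma lowSymbol_nonneg (R : ℝ) (ξ : Eu d) : 0 ≤ lowSymbol R ξ := (cutoffBump d).nonneg

lemma lowSymbol_le_one (R : ℝ) (ξ : Eu d) : lowSymbol R ξ ≤ 1 := (cutoffBump d).le_one

lemma lowSymbol_eq_one {R : ℝ} (hR : 0 < R) {ξ : Eu d} (h : ‖ξ‖ ≤ R) : lowSymbol R ξ = 1 := by
  refine (cutoffBump d).one_of_mem_closedBall ?_
  rw [mem_closedBall_zero_iff, norm_smul, norm_inv, Real.norm_of_nonneg hR.le]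
  exact (inv_mul_le_one₀ hR).2 h

lemma hasCompactSupport_lowSymbol {R : ℝ} (hR : 0 < R) :
    HasCompactSupport (lowSymbol (d := d) R) :=
  (cutoffBump d).hasCompactSupport.comp_homeomorph (Homeomorph.smulOfNeZero R⁻¹ (by positivity))

lemma hasTemperateGrowth_lowSymbol {R : ℝ} (hR : 0 < R) :
    (lowSymbol (d := d) R).HasTemperateGrowth :=
  (hasCompactSupport_lowSymbol hR).hasTemperateGrowth (contDiff_lowSymbol R)

lemma highSymbol_eq_zero {s R : ℝ} (hR : 0 < R) {ξ : Eu d} (h : ‖ξ‖ ≤ R) :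
    highSymbol s R ξ = 0 := by
  rw [highSymbol, lowSymbol_eq_one hR h, sub_self, zero_mul]

lemma highSymbol_nonneg (s R : ℝ) (ξ : Eu d) : 0 ≤ highSymbol s R ξ :=
  mul_nonneg (sub_nonneg.2 (lowSymbol_le_one R ξ)) (by positivity)

lemma highSymbol_le (s R : ℝ) (ξ : Eu d) : highSymbol s R ξ ≤ (2 * Real.pi * ‖ξ‖) ^ (-s) :=
  mul_le_of_le_one_left (by positivity) (by linarith [lowSymbol_nonneg R ξ])

/-- The singularity of `|ξ|^{-s}` lies where `1 - lowSymbol` vanishes. Adding a bump to `‖η‖²` keeps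
it above `1/2` without changing it for `‖η‖ ≥ 1`, so after rescaling by `R` the singular power may
be replaced by a smooth one. -/
lemma hasTemperateGrowth_highSymbol (s : ℝ) {R : ℝ} (hR : 0 < R) :
    (highSymbol (d := d) s R).HasTemperateGrowth := by
  let χ : ContDiffBump (0 : Eu d) := ⟨3 / 4, 1, by norm_num, by norm_num⟩
  have hχ : (fun η => ‖η‖ ^ 2 + χ η).HasTemperateGrowth :=
    (Function.hasTemperateGrowth_norm_sq _).add
      (χ.hasCompactSupport.hasTemperateGrowth χ.contDiff)
  have hχ' : ∀ η, 1 / 2 < ‖η‖ ^ 2 + χ η := by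
    intro η
    rcases le_or_gt ‖η‖ (3 / 4) with h | h
    · rw [χ.one_of_mem_closedBall (by simpa using h)]
      nlinarith [sq_nonneg ‖η‖]
    · nlinarith [χ.nonneg (x := η)]
  have hlin : (fun ξ : Eu d => R⁻¹ • ξ).HasTemperateGrowth :=
    (R⁻¹ • ContinuousLinearMap.id ℝ (Eu d)).hasTemperateGrowth
  have hbase := (hχ.rpow_const_of_half_lt hχ' (-s / 2)).comp hlin
  have heq : highSymbol (d := d) s R = fun ξ => (2 * Real.pi * R) ^ (-s) *
      ((1 - lowSymbol R ξ) * (‖R⁻¹ • ξ‖ ^ 2 + χ (R⁻¹ • ξ)) ^ (-s / 2)) := by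
    ext ξ
    rcases le_or_gt ‖ξ‖ R with h | h
    · rw [highSymbol, lowSymbol_eq_one hR h, sub_self]
      simp
    · have h1 : ‖R⁻¹ • ξ‖ = R⁻¹ * ‖ξ‖ := by
        rw [norm_smul, norm_inv, Real.norm_of_nonneg hR.le]
      have hξ : 0 < ‖ξ‖ := hR.trans h
      rw [χ.zero_of_le_dist (by
        rw [dist_zero_right, h1]; exact (le_inv_mul_iff₀ hR).2 (by rw [mul_one]; exact h.le)),
        add_zero, h1, highSymbol, ← Real.rpow_natCast, ← Real.rpow_mul (by positivity)]
      rw [show ((2 : ℕ) : ℝ) * (-s / 2) = -s by push_cast; ring, mul_left_comm,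
        ← Real.mul_rpow (by positivity) (by positivity)]
      congr 2
      field_simp
  rw [heq]
  exact (Function.HasTemperateGrowth.const _).mul
    (((Function.HasTemperateGrowth.const _).sub (hasTemperateGrowth_lowSymbol hR)).mul hbase)

lemma contDiff_ofReal_lowSymbol (R : ℝ) :
    ContDiff ℝ (⊤ : ℕ∞) (fun ξ : Eu d => (lowSymbol R ξ : ℂ)) :=
  Complex.ofRealCLM.contDiff.comp (contDiff_lowSymbol R)

lemma hasCompactSupport_ofReal_lowSymbol {R : ℝ} (hR : 0 < R) :
    HasCompactSupport (fun ξ : Eu d => (lowSymbol R ξ : ℂ)) :=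
  (hasCompactSupport_lowSymbol hR).comp_left Complex.ofReal_zero

/-- The kernel of the low-frequency projection. -/
noncomputable def lowKernel (d : ℕ) {R : ℝ} (hR : 0 < R) : 𝓢(Eu d, ℂ) :=
  𝓕⁻ ((hasCompactSupport_ofReal_lowSymbol hR).toSchwartzMap (contDiff_ofReal_lowSymbol R))

lemma fourier_lowKernel_apply {R : ℝ} (hR : 0 < R) (ξ : Eu d) :
    (𝓕 (lowKernel d hR) : 𝓢(Eu d, ℂ)) ξ = lowSymbol R ξ := by
  rw [lowKernel, FourierTransform.fourier_fourierInv_eq,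
    HasCompactSupport.toSchwartzMap_toFun]

lemma lowKernel_apply {R : ℝ} (hR : 0 < R) (x : Eu d) :
    lowKernel d hR x = ∫ ξ, Real.fourierChar (inner ℝ ξ x) • (lowSymbol R ξ : ℂ) := by
  rw [lowKernel, SchwartzMap.fourierInv_coe, Real.fourierInv_eq]
  simp only [HasCompactSupport.toSchwartzMap_toFun]

lemma lowKernel_eq {R : ℝ} (hR : 0 < R) (x : Eu d) :
    lowKernel d hR x = (R : ℂ) ^ d * lowKernel d one_pos (R • x) := by
  rw [lowKernel_apply, lowKernel_apply]
  have := Measure.integral_comp_smul (volume : Measure (Eu d))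
    (fun η => Real.fourierChar (inner ℝ η (R • x)) • (lowSymbol 1 η : ℂ)) R⁻¹
  rw [finrank_euclideanSpace_fin, abs_of_pos (by positivity), inv_pow, inv_inv,
    Complex.real_smul, Complex.ofReal_pow] at this
  convert this using 4 with ξ
  · rw [inner_smul_left, inner_smul_right]
    simp [hR.ne']
  · simp [lowSymbol]

/-- The kernels are `L¹`-normalised dilates of a single Schwartz function: the mass does not depend
on `R` and the supremum scales like `R^d`. -/
lemma exists_lowKernel_bounds (d : ℕ) : ∃ K₁ K₂ : ℝ, 0 ≤ K₁ ∧ 0 ≤ K₂ ∧ ∀ {R : ℝ} (hR : 0 < R),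
    ∫⁻ x, ‖lowKernel d hR x‖ₑ ≤ ENNReal.ofReal K₁ ∧ ∀ x, ‖lowKernel d hR x‖ ≤ K₂ * R ^ d := by
  obtain ⟨C, hC⟩ := (lowKernel d one_pos).decay 0 0
  refine ⟨∫ x, ‖lowKernel d one_pos x‖, C, by positivity, hC.1.le, fun {R} hR => ⟨?_, fun x => ?_⟩⟩
  · have hint : Integrable (fun x => ‖lowKernel d hR x‖) := (lowKernel d hR).integrable.norm
    simp_rw [← ofReal_norm]
    rw [← ofReal_integral_eq_lintegral_ofReal hint (.of_forall fun _ => norm_nonneg _)]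
    refine ENNReal.ofReal_le_ofReal (le_of_eq ?_)
    simp_rw [lowKernel_eq hR, norm_mul, integral_const_mul]
    rw [Measure.integral_comp_smul (volume : Measure (Eu d))
      (fun x => ‖lowKernel d one_pos x‖) R, finrank_euclideanSpace_fin, abs_of_pos (by positivity)]
    simp [hR.ne', abs_of_pos hR]
  · rw [lowKernel_eq hR, norm_mul, mul_comm]
    have := hC.2 (R • x)
    simp only [pow_zero, norm_iteratedFDeriv_zero, one_mul] at this
    rw [norm_pow, Complex.norm_real, Real.norm_of_nonneg hR.le]
    gcongr

/-- The high-frequency part of `Λ^{-s} φ`. -/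
noncomputable def highPart (s R : ℝ) (φ : 𝓢(Eu d, ℂ)) : 𝓢(Eu d, ℂ) :=
  𝓕⁻ (SchwartzMap.smulLeftCLM ℂ (highSymbol (d := d) s R) (𝓕 φ))

lemma fourier_highPart_apply (s : ℝ) {R : ℝ} (hR : 0 < R) (φ : 𝓢(Eu d, ℂ)) (ξ : Eu d) :
    (𝓕 (highPart s R φ) : 𝓢(Eu d, ℂ)) ξ =
      (highSymbol s R ξ : ℂ) * (𝓕 φ : 𝓢(Eu d, ℂ)) ξ := by
  rw [highPart, FourierTransform.fourier_fourierInv_eq,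
    SchwartzMap.smulLeftCLM_apply_apply (hasTemperateGrowth_highSymbol s hR), Complex.real_smul]

/-- The symbol vanishes on a whole ball around the origin, so every Schwartz `φ` yields an
admissible test function for `Λˢ f = h`. -/
lemma highPart_mem_schwartzZero (s : ℝ) {R : ℝ} (hR : 0 < R) (φ : 𝓢(Eu d, ℂ)) :
    highPart s R φ ∈ SchwartzZero d := by
  intro n
  have : (⇑(𝓕 (highPart s R φ) : 𝓢(Eu d, ℂ))) =ᶠ[nhds 0] fun _ => 0 := by
    filter_upwards [Metric.closedBall_mem_nhds (0 : Eu d) hR] with ξ hξ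
    rw [fourier_highPart_apply s hR, highSymbol_eq_zero hR (by simpa using hξ)]
    simp
  have h2 := (this.iteratedFDeriv ℝ n).self_of_nhds
  rw [h2]
  simp

/-- The powers `(2π|ξ|)^{±s}` cancel on the Fourier side and leave `1 - lowSymbol`, that is, the
identity minus the low-frequency projection. -/
lemma fracLaplacian_highPart (s : ℝ) {R : ℝ} (hR : 0 < R) (φ : 𝓢(Eu d, ℂ)) (x : Eu d) :
    fracLaplacian s (highPart s R φ) x = φ x - ∫ t, lowKernel d hR (x - t) * φ t := by
  set B := ContinuousLinearMap.mul ℂ ℂ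
  have h1 : (fun ξ : Eu d => (((2 * Real.pi * ‖ξ‖) ^ s : ℝ) : ℂ) *
      (𝓕 (highPart s R φ) : 𝓢(Eu d, ℂ)) ξ) =
      ⇑(𝓕 (φ - SchwartzMap.convolution B (lowKernel d hR) φ) : 𝓢(Eu d, ℂ)) := by
    ext ξ
    rw [sub_eq_add_neg, FourierTransform.fourier_add, FourierTransform.fourier_neg,
      SchwartzMap.fourier_convolution, ← sub_eq_add_neg, sub_apply,
      SchwartzMap.pairing_apply_apply, fourier_highPart_apply s hR, fourier_lowKernel_apply hR]
    simp only [B, ContinuousLinearMap.mul_apply']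
    rcases le_or_gt ‖ξ‖ R with h | h
    · rw [highSymbol_eq_zero hR h, lowSymbol_eq_one hR h]
      simp
    · have hξ : 0 < 2 * Real.pi * ‖ξ‖ := by have := hR.trans h; positivity
      have h3 : (((2 * Real.pi * ‖ξ‖) ^ s : ℝ) : ℂ) *
          (((2 * Real.pi * ‖ξ‖) ^ (-s) : ℝ) : ℂ) = 1 := by
        rw [← Complex.ofReal_mul, ← Real.rpow_add hξ, add_neg_cancel, Real.rpow_zero]
        simp
      rw [highSymbol]
      push_cast at h3 ⊢
      linear_combination (1 - (lowSymbol R ξ : ℂ)) * (𝓕 φ : 𝓢(Eu d, ℂ)) ξ * h3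
  rw [fracLaplacian, h1, ← SchwartzMap.fourierInv_coe, FourierTransform.fourierInv_fourier_eq,
    sub_apply, SchwartzMap.convolution_apply, convolution_mul_swap]

end Cutoff

/-! ### Splitting a function by frequency. -/

section Decomposition

variable {d : ℕ}

lemma integral_Lp_mul_fourier (v : Lp ℂ 2 (volume : Measure (Eu d))) (φ : 𝓢(Eu d, ℂ)) :
    ∫ ξ, v ξ * (𝓕 φ : 𝓢(Eu d, ℂ)) ξ = ∫ x, (𝓕 v : Lp ℂ 2 (volume : Measure (Eu d))) x * φ x := by
  have h := DFunLike.congr_fun (Lp.fourier_toTemperedDistribution_eq v) φ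
  rw [TemperedDistribution.fourier_apply, Lp.toTemperedDistribution_apply,
    Lp.toTemperedDistribution_apply] at h
  simpa only [smul_eq_mul, mul_comm] using h

lemma integral_mul_fourier {w : Eu d → ℂ} (hw : Integrable w) (φ : 𝓢(Eu d, ℂ)) :
    ∫ ξ, w ξ * (𝓕 φ : 𝓢(Eu d, ℂ)) ξ = ∫ x, 𝓕 w x * φ x := by
  have h := VectorFourier.integral_bilin_fourierIntegral_eq_flip (ContinuousLinearMap.mul ℂ ℂ)
    (L := innerₗ (Eu d)) Real.continuous_fourierChar continuous_inner hw
    (φ.integrable (μ := volume))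
  simpa using! h.symm

lemma continuous_fourier_of_integrable {w : Eu d → ℂ} (hw : Integrable w) : Continuous (𝓕 w) :=
  VectorFourier.fourierIntegral_continuous Real.continuous_fourierChar
    (L := innerₗ (Eu d)) continuous_inner hw

/-- The pairing is bilinear, without conjugation, so Plancherel places the inverse transform on `h`.
-/
lemma integral_mul_highPart {h : Eu d → ℂ} (hh : MemLp h 2) (s : ℝ) {R : ℝ} (hR : 0 < R)
    (φ : 𝓢(Eu d, ℂ)) :
    ∫ x, h x * highPart s R φ x =
      ∫ ξ, (𝓕⁻ hh.toLp : Lp ℂ 2 (volume : Measure (Eu d))) ξ *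
        (highSymbol s R ξ * (𝓕 φ : 𝓢(Eu d, ℂ)) ξ) := by
  have := integral_Lp_mul_fourier (𝓕⁻ hh.toLp) (highPart s R φ)
  rw [FourierTransform.fourier_fourierInv_eq] at this
  simp_rw [fourier_highPart_apply s hR] at this
  rw [this]
  refine integral_congr_ae ?_
  filter_upwards [hh.coeFn_toLp] with x hx
  rw [hx]

/-- Fubini for the low-frequency projection. -/
lemma integral_mul_integral_kernel {f k : Eu d → ℂ} (hf : AEStronglyMeasurable f)
    (hk : Continuous k) {C : ℝ≥0}
    (hC : ∀ y, ∫⁻ x, ‖f x‖ₑ * ‖k (x - y)‖ₑ ≤ C) (φ : 𝓢(Eu d, ℂ)) :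
    Integrable (fun x => f x * ∫ t, k (x - t) * φ t) ∧
    ∫ x, f x * ∫ t, k (x - t) * φ t = ∫ t, (∫ x, f x * k (x - t)) * φ t := by
  have hint : Integrable (Function.uncurry fun x t => f x * (k (x - t) * φ t))
      ((volume : Measure (Eu d)).prod volume) := by
    have hmeas : AEStronglyMeasurable (Function.uncurry fun x t => f x * (k (x - t) * φ t))
        ((volume : Measure (Eu d)).prod volume) :=
      hf.comp_fst.mul (by
        have : Continuous fun p : Eu d × Eu d => k (p.1 - p.2) * φ p.2 := by fun_prop
        exact this.aestronglyMeasurable)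
    refine ⟨hmeas, ?_⟩
    rw [HasFiniteIntegral, lintegral_prod_symm _ hmeas.enorm]
    calc _ ≤ ∫⁻ t, C * ‖φ t‖ₑ := by
          refine lintegral_mono fun t => ?_
          simp only [Function.uncurry_apply_pair, enorm_mul, ← mul_assoc]
          rw [lintegral_mul_const' _ _ enorm_ne_top]
          gcongr
          exact hC t
      _ < ∞ := by
          rw [lintegral_const_mul' _ _ ENNReal.coe_ne_top]
          exact ENNReal.mul_lt_top ENNReal.coe_lt_top φ.integrable.2
  refine ⟨?_, ?_⟩
  · have := hint.integral_prod_left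
    simpa only [Function.uncurry_apply_pair, integral_const_mul] using this
  · have := integral_integral_swap hint
    simp_rw [integral_const_mul, ← mul_assoc, integral_mul_const] at this
    exact this

/-- Decomposition of `f` with `Λˢ f = h` into a low-frequency part and a high-frequency part, the
latter split as a sum of an integrable and a square integrable function on the Fourier side. -/
theorem ae_eq_low_add_high {f h w v : Eu d → ℂ} {s R : ℝ} (hR : 0 < R)
    (hfh : IsFracLaplacian s f h) (hh : MemLp h 2) (hf : LocallyIntegrable f) {C : ℝ≥0}
    (hC : ∀ y, ∫⁻ x, ‖f x‖ₑ * ‖lowKernel d hR (x - y)‖ₑ ≤ C)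
    (hw : Integrable w) (hv : MemLp v 2)
    (hwv : ∀ᵐ ξ, w ξ + v ξ = highSymbol s R ξ * (𝓕⁻ hh.toLp : Lp ℂ 2 (volume : Measure (Eu d))) ξ) :
    ∀ᵐ y, f y = (∫ x, f x * lowKernel d hR (x - y)) + 𝓕 w y +
      (𝓕 hv.toLp : Lp ℂ 2 (volume : Measure (Eu d))) y := by
  have hfm : AEStronglyMeasurable f volume := hf.aestronglyMeasurable
  have hlow : LocallyIntegrable (fun y => ∫ x, f x * lowKernel d hR (x - y)) := by
    refine (locallyIntegrable_const (C : ℝ)).mono ?_ (.of_forall fun y => ?_)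
    · refine AEStronglyMeasurable.integral_prod_right'
        (f := fun p : Eu d × Eu d => f p.2 * lowKernel d hR (p.2 - p.1)) ?_
      refine hfm.comp_snd.mul ?_
      have : Continuous fun p : Eu d × Eu d => lowKernel d hR (p.2 - p.1) := by fun_prop
      exact this.aestronglyMeasurable
    · have h1 := (enorm_integral_le_lintegral_enorm
        fun x => f x * lowKernel d hR (x - y)).trans
        (by simpa only [enorm_mul] using hC y)
      rw [NNReal.norm_eq]
      rw [enorm_le_coe] at h1
      exact_mod_cast h1
  have hFw : LocallyIntegrable (𝓕 w) := (continuous_fourier_of_integrable hw).locallyIntegrable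
  have hFv : LocallyIntegrable (𝓕 hv.toLp : Lp ℂ 2 (volume : Measure (Eu d))) :=
    (Lp.memLp _).locallyIntegrable (by norm_num)
  refine ae_eq_of_integral_contDiff_smul_eq hf ((hlow.add hFw).add hFv) fun g hg hgs => ?_
  set φ : 𝓢(Eu d, ℂ) := HasCompactSupport.toSchwartzMap (f := fun x => (g x : ℂ))
    (hgs.comp_left Complex.ofReal_zero) (Complex.ofRealCLM.contDiff.comp hg) with hφ_def
  have hφ : ∀ x, φ x = (g x : ℂ) := fun x => rfl
  have hint : ∀ {u : Eu d → ℂ}, LocallyIntegrable u → Integrable fun x => u x * φ x := by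
    intro u hu
    have := hu.integrable_smul_left_of_hasCompactSupport hg.continuous hgs
    simpa only [hφ, Complex.real_smul, mul_comm] using this
  obtain ⟨hi, hswap⟩ := integral_mul_integral_kernel hfm (SchwartzMap.continuous _) hC φ
  -- Testing with `highPart s R φ` expresses `∫ f φ` as the low-frequency pairing plus a pairing of
  -- `h`, with `φ` an arbitrary bump.
  have hmain := (hfh _ (highPart_mem_schwartzZero s hR φ)).2.2
  simp_rw [fracLaplacian_highPart s hR φ, mul_sub] at hmain
  rw [integral_sub (hint hf) hi, hswap, integral_mul_highPart hh s hR φ, sub_eq_iff_eq_add] at hmain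
  have hhigh : ∫ ξ, (𝓕⁻ hh.toLp : Lp ℂ 2 (volume : Measure (Eu d))) ξ *
      (highSymbol s R ξ * (𝓕 φ : 𝓢(Eu d, ℂ)) ξ) =
      (∫ x, 𝓕 w x * φ x) + ∫ x, (𝓕 hv.toLp : Lp ℂ 2 (volume : Measure (Eu d))) x * φ x := by
    rw [← integral_mul_fourier hw, ← integral_Lp_mul_fourier, ← integral_add]
    · refine integral_congr_ae ?_
      filter_upwards [hwv, hv.coeFn_toLp] with ξ h1 h2
      rw [h2, ← add_mul, h1]
      ring
    · obtain ⟨c, hc⟩ := (𝓕 φ : 𝓢(Eu d, ℂ)).decay 0 0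
      refine hw.mul_bdd (c := c) (SchwartzMap.continuous _).aestronglyMeasurable
        (.of_forall fun x => ?_)
      simpa using hc.2 x
    · exact (Lp.memLp _).integrable_mul ((𝓕 φ : 𝓢(Eu d, ℂ)).memLp 2)
  rw [hhigh] at hmain
  have hsmul : ∀ u : Eu d → ℂ, ∫ x, g x • u x = ∫ x, u x * φ x := fun u => by
    simp only [hφ, Complex.real_smul, mul_comm]
  rw [hsmul, hsmul, hmain]
  simp only [add_mul]
  rw [integral_add (f := fun y => (∫ x, f x * lowKernel d hR (x - y)) * φ y + 𝓕 w y * φ y)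
    ((hint hlow).add (hint hFw)) (hint hFv), integral_add (hint hlow) (hint hFw)]
  ring

end Decomposition

/-! ### Bounds for the three frequency ranges and the distribution function. -/

section DistributionEstimate

variable {d : ℕ}

lemma eLpNorm_fourier_eq (v : Lp ℂ 2 (volume : Measure (Eu d))) :
    eLpNorm (𝓕 v : Lp ℂ 2 (volume : Measure (Eu d))) 2 = eLpNorm v 2 := by
  rw [← Lp.enorm_def, ← Lp.enorm_def, ← ofReal_norm, ← ofReal_norm, Lp.norm_fourier_eq]

lemma eLpNorm_fourierInv_toLp_eq {h : Eu d → ℂ} (hh : MemLp h 2) :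
    eLpNorm (𝓕⁻ hh.toLp : Lp ℂ 2 (volume : Measure (Eu d))) 2 = eLpNorm h 2 := by
  rw [← eLpNorm_fourier_eq, FourierTransform.fourier_fourierInv_eq,
    eLpNorm_congr_ae hh.coeFn_toLp]

/-- A function in weak `L^p`, `p > 1`, is locally integrable. -/
lemma locallyIntegrable_of_meas_le {f : Eu d → ℂ} (hf : AEStronglyMeasurable f) {p A : ℝ}
    (hp : 1 < p) (hA : 0 < A)
    (h : ∀ t, 0 < t → volume {x | t < ‖f x‖} ≤ ENNReal.ofReal ((A / t) ^ p)) :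
    LocallyIntegrable f := by
  have hmeas : NullMeasurableSet {x | 1 < ‖f x‖} volume :=
    nullMeasurableSet_lt aemeasurable_const hf.norm.aemeasurable
  have hint : Integrable ({x | 1 < ‖f x‖}.indicator f) := by
    refine ⟨hf.indicator₀ hmeas, ?_⟩
    refine lt_of_le_of_lt (le_of_eq ?_)
      ((lintegral_indicator_lt_norm_le hf hp hA one_pos h).trans_lt ENNReal.ofReal_lt_top)
    exact lintegral_congr fun x => enorm_indicator_eq_indicator_enorm f x
  refine ((locallyIntegrable_const (1 : ℝ)).add hint.norm.locallyIntegrable).mono hf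
    (.of_forall fun x => ?_)
  rw [Pi.add_apply, Real.norm_of_nonneg (by positivity)]
  by_cases hx : 1 < ‖f x‖
  · rw [Set.indicator_of_mem (by exact hx)]
    linarith
  · linarith [not_lt.1 hx, norm_nonneg ({x | 1 < ‖f x‖}.indicator f x)]

/-- Below `R * L` one may insert `(R L / |ξ|)^y ≥ 1`, trading a factor `L^y` for the extra decay
that makes the weight square integrable. On the support `|ξ| > R`, so `|ξ|` is comparable with `R +
|ξ|`. -/
lemma highSymbol_le_of_norm_lt {s y R L : ℝ} (hs : 0 < s) (hy : 0 ≤ y) (hR : 0 < R)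
    {ξ : Eu d} (hξ : ‖ξ‖ < R * L) :
    highSymbol s R ξ ≤ 2 ^ (s + y) * L ^ y * R ^ (-s) * (1 + ‖R⁻¹ • ξ‖) ^ (-(s + y)) := by
  have hL : 0 < L := pos_of_mul_pos_right ((norm_nonneg ξ).trans_lt hξ) hR.le
  rcases le_or_gt ‖ξ‖ R with h | h
  · rw [highSymbol_eq_zero hR h]
    positivity
  have hξ0 : 0 < ‖ξ‖ := hR.trans h
  have hpi : 1 ≤ 2 * Real.pi := by linarith [Real.pi_gt_three]
  calc highSymbol s R ξ ≤ (2 * Real.pi * ‖ξ‖) ^ (-s) := highSymbol_le s R ξ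
    _ ≤ ‖ξ‖ ^ (-s) := Real.rpow_le_rpow_of_nonpos hξ0
        (le_mul_of_one_le_left hξ0.le hpi) (by linarith)
    _ ≤ ‖ξ‖ ^ (-s) * (R * L / ‖ξ‖) ^ y := le_mul_of_one_le_right (by positivity)
        (Real.one_le_rpow ((one_le_div hξ0).2 hξ.le) hy)
    _ = (R * L) ^ y * ‖ξ‖ ^ (-(s + y)) := by
        rw [Real.div_rpow (by positivity) hξ0.le, neg_add, Real.rpow_add hξ0,
          Real.rpow_neg hξ0.le y]
        ring
    _ ≤ (R * L) ^ y * (R * (1 + ‖R⁻¹ • ξ‖) / 2) ^ (-(s + y)) := by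
        refine mul_le_mul_of_nonneg_left (Real.rpow_le_rpow_of_nonpos (by positivity) ?_
          (by linarith)) (by positivity)
        rw [norm_smul, norm_inv, Real.norm_of_nonneg hR.le]
        field_simp
        linarith
    _ = _ := by
        rw [Real.div_rpow (by positivity) (by norm_num), Real.mul_rpow hR.le hL.le,
          Real.mul_rpow hR.le (by positivity : 0 ≤ 1 + ‖R⁻¹ • ξ‖),
          Real.rpow_neg (by norm_num : (0 : ℝ) ≤ 2), div_inv_eq_mul,
          neg_add, Real.rpow_add hR, Real.rpow_neg hR.le y]
        field_simp

lemma highSymbol_le_of_le_norm {s R r : ℝ} (hs : 0 < s) (hr : 0 < r) {ξ : Eu d} (hξ : r ≤ ‖ξ‖) :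
    highSymbol s R ξ ≤ r ^ (-s) := by
  refine (highSymbol_le s R ξ).trans (Real.rpow_le_rpow_of_nonpos hr ?_ (by linarith))
  nlinarith [Real.pi_gt_three]

/-- The medium frequencies: bound for the `L^1` norm of the Fourier transform. -/
lemma exists_lintegral_indicator_highSymbol_mul_le {s y : ℝ} (hs : 0 < s) (hy : 0 ≤ y)
    (hsy : (d : ℝ) < 2 * (s + y)) :
    ∃ C : ℝ, 0 ≤ C ∧ ∀ {R L B : ℝ} (H : Eu d → ℂ), 0 < R → 0 < L → 0 ≤ B →
      AEStronglyMeasurable H → eLpNorm H 2 ≤ ENNReal.ofReal B →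
      ∫⁻ ξ, ‖(Metric.ball (0 : Eu d) (R * L)).indicator (fun ξ => highSymbol s R ξ * H ξ) ξ‖ₑ ≤
        ENNReal.ofReal (C * (B * L ^ y * R ^ ((d : ℝ) / 2 - s))) := by
  set J : ℝ := ∫ ξ : Eu d, (1 + ‖ξ‖) ^ (-(2 * (s + y))) with hJ
  have hJ0 : 0 ≤ J := by positivity
  have hJint : Integrable fun ξ : Eu d => (1 + ‖ξ‖) ^ (-(2 * (s + y))) :=
    integrable_one_add_norm (by rwa [finrank_euclideanSpace_fin])
  refine ⟨2 ^ (s + y) * Real.sqrt J, by positivity, fun {R L B} H hR hL hB hH hHB => ?_⟩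
  set c : ℝ := 2 ^ (s + y) * L ^ y * R ^ (-s) with hc
  set G : Eu d → ℝ := fun ξ => c * (1 + ‖R⁻¹ • ξ‖) ^ (-(s + y)) with hG
  have hc0 : 0 ≤ c := by positivity
  have hG0 : ∀ ξ, 0 ≤ G ξ := fun ξ => by positivity
  have hGcont : Continuous G := by
    refine continuous_const.mul (Continuous.rpow_const (by fun_prop) fun ξ => Or.inl ?_)
    positivity
  have hGsq : ∀ ξ, ENNReal.ofReal (G ξ) ^ (2 : ℝ) =
      ENNReal.ofReal (c ^ 2 * (1 + ‖R⁻¹ • ξ‖) ^ (-(2 * (s + y)))) := by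
    intro ξ
    rw [ENNReal.ofReal_rpow_of_nonneg (hG0 ξ) (by norm_num), Real.rpow_two, hG, mul_pow,
      ← Real.rpow_mul_natCast (by positivity)]
    congr 3
    push_cast
    ring
  have hGint : ∫⁻ ξ, ENNReal.ofReal (G ξ) ^ (2 : ℝ) = ENNReal.ofReal (c ^ 2 * (R ^ d * J)) := by
    simp_rw [hGsq]
    rw [← ofReal_integral_eq_lintegral_ofReal
      ((hJint.comp_smul (inv_ne_zero hR.ne')).const_mul _) (.of_forall fun ξ => by positivity),
      integral_const_mul, Measure.integral_comp_smul (volume : Measure (Eu d))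
      (fun ξ => (1 + ‖ξ‖) ^ (-(2 * (s + y)))) R⁻¹, finrank_euclideanSpace_fin, inv_pow, inv_inv,
      abs_of_pos (by positivity), smul_eq_mul]
  calc _ ≤ ∫⁻ ξ, ENNReal.ofReal (G ξ) * ‖H ξ‖ₑ := by
        refine lintegral_mono fun ξ => ?_
        by_cases hξ : ξ ∈ Metric.ball (0 : Eu d) (R * L)
        · rw [Set.indicator_of_mem hξ, enorm_mul]
          gcongr
          rw [← ofReal_norm, Complex.norm_real, Real.norm_of_nonneg (highSymbol_nonneg _ _ _)]
          exact ENNReal.ofReal_le_ofReal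
            (highSymbol_le_of_norm_lt hs hy hR (mem_ball_zero_iff.1 hξ))
        · rw [Set.indicator_of_notMem hξ, enorm_zero]
          exact zero_le
    _ ≤ (∫⁻ ξ, ENNReal.ofReal (G ξ) ^ (2 : ℝ)) ^ (1 / (2 : ℝ)) *
          (∫⁻ ξ, ‖H ξ‖ₑ ^ (2 : ℝ)) ^ (1 / (2 : ℝ)) :=
        ENNReal.lintegral_mul_le_Lp_mul_Lq _ (Real.HolderConjugate.two_two)
          hGcont.measurable.ennreal_ofReal.aemeasurable hH.enorm
    _ ≤ ENNReal.ofReal (c * (R ^ ((d : ℝ) / 2) * Real.sqrt J)) * ENNReal.ofReal B := by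
        refine mul_le_mul' (le_of_eq ?_) ?_
        · rw [hGint, ENNReal.ofReal_rpow_of_nonneg (by positivity) (by norm_num),
            ← Real.sqrt_eq_rpow, Real.sqrt_mul (by positivity), Real.sqrt_sq hc0,
            Real.sqrt_mul (by positivity), Real.sqrt_eq_rpow (R ^ d), ← Real.rpow_natCast_mul hR.le]
          congr 4
          ring
        · refine le_trans (le_of_eq ?_) hHB
          rw [eLpNorm_eq_lintegral_rpow_enorm_toReal (by norm_num) (by norm_num)]
          simp
    _ = _ := by
        rw [← ENNReal.ofReal_mul (by positivity)]
        congr 1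
        rw [hc, sub_eq_add_neg, Real.rpow_add hR]
        ring

/-- The high frequencies. -/
lemma eLpNorm_indicator_highSymbol_mul_le {s R L B : ℝ} (hs : 0 < s) (hR : 0 < R) (hL : 0 < L)
    {H : Eu d → ℂ} (hHB : eLpNorm H 2 ≤ ENNReal.ofReal B) :
    eLpNorm ((Metric.ball (0 : Eu d) (R * L))ᶜ.indicator fun ξ => highSymbol s R ξ * H ξ) 2 ≤
      ENNReal.ofReal ((R * L) ^ (-s) * B) := by
  have hRL : 0 < R * L := by positivity
  rw [ENNReal.ofReal_mul (by positivity)]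
  refine (eLpNorm_le_mul_eLpNorm_of_ae_le_mul (c := (R * L) ^ (-s)) (g := H)
    (.of_forall fun ξ => ?_) 2).trans (by gcongr)
  by_cases hξ : ξ ∈ (Metric.ball (0 : Eu d) (R * L))ᶜ
  · rw [Set.indicator_of_mem hξ, norm_mul, Complex.norm_real,
      Real.norm_of_nonneg (highSymbol_nonneg _ _ _)]
    gcongr
    exact highSymbol_le_of_le_norm hs hRL (by simpa using hξ)
  · rw [Set.indicator_of_notMem hξ, norm_zero]
    positivity

lemma enorm_fourier_le_lintegral_enorm (w : Eu d → ℂ) (x : Eu d) : ‖𝓕 w x‖ₑ ≤ ∫⁻ ξ, ‖w ξ‖ₑ := by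
  rw [Real.fourier_eq]
  refine (enorm_integral_le_lintegral_enorm _).trans (le_of_eq (lintegral_congr fun v => ?_))
  rw [← ofReal_norm, Circle.norm_smul, ofReal_norm]

/-- A function in weak `L^p` with `Λˢ f ∈ L²` is the sum of a bounded function and a function
in `L²`, with bounds depending on the frequency scales `R` and `R * L`. -/
theorem exists_norm_le_add_norm {p s y : ℝ} (hp : 1 < p) (hs : 0 < s) (hy : 0 ≤ y)
    (hsy : (d : ℝ) < 2 * (s + y)) :
    ∃ C : ℝ, 0 < C ∧ ∀ {f h : Eu d → ℂ} {A B : ℝ}, 0 < A → 0 < B → AEStronglyMeasurable f →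
      (∀ t, 0 < t → volume {x | t < ‖f x‖} ≤ ENNReal.ofReal ((A / t) ^ p)) →
      MemLp h 2 → eLpNorm h 2 ≤ ENNReal.ofReal B → IsFracLaplacian s f h →
      ∀ {R L : ℝ}, 0 < R → 0 < L →
        ∃ V : Eu d → ℂ, AEStronglyMeasurable V ∧
          eLpNorm V 2 ≤ ENNReal.ofReal ((R * L) ^ (-s) * B) ∧
          ∀ᵐ x, ‖f x‖ ≤
            C * (A * R ^ (d / p) + B * L ^ y * R ^ ((d : ℝ) / 2 - s)) + ‖V x‖ := by
  obtain ⟨K₁, K₂, hK₁, hK₂, hK⟩ := exists_lowKernel_bounds d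
  obtain ⟨C', hC', hmed⟩ := exists_lintegral_indicator_highSymbol_mul_le hs hy hsy
  have hp' : 0 < p - 1 := by linarith
  obtain ⟨C₀, hC₀⟩ : ∃ C₀, C₀ = K₁ + K₂ * (p / (p - 1)) := ⟨_, rfl⟩
  have hC₀0 : 0 ≤ C₀ := hC₀ ▸ by positivity
  -- The summand `1` only makes the constant strictly positive, as later divisions by it require.
  refine ⟨C₀ + C' + 1, by positivity, ?_⟩
  intro f h A B hA hB hf hdist hh hhB hfh R L hR hL
  obtain ⟨H, hH⟩ : ∃ H : Lp ℂ 2 (volume : Measure (Eu d)), H = 𝓕⁻ hh.toLp := ⟨_, rfl⟩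
  have hHB : eLpNorm H 2 ≤ ENNReal.ofReal B := by rwa [hH, eLpNorm_fourierInv_toLp_eq]
  have hum : AEStronglyMeasurable (fun ξ : Eu d => (highSymbol s R ξ : ℂ) * H ξ) volume := by
    refine AEStronglyMeasurable.mul ?_ (Lp.aestronglyMeasurable H)
    exact (Complex.continuous_ofReal.comp
      (hasTemperateGrowth_highSymbol s hR).1.continuous).aestronglyMeasurable
  have hwB := hmed H hR hL hB.le (Lp.aestronglyMeasurable H) hHB
  have hvB := eLpNorm_indicator_highSymbol_mul_le hs hR hL hHB
  have hw : Integrable ((Metric.ball (0 : Eu d) (R * L)).indicator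
      fun ξ => (highSymbol s R ξ : ℂ) * H ξ) :=
    ⟨hum.indicator measurableSet_ball, hwB.trans_lt ENNReal.ofReal_lt_top⟩
  have hv : MemLp ((Metric.ball (0 : Eu d) (R * L))ᶜ.indicator
      fun ξ => (highSymbol s R ξ : ℂ) * H ξ) 2 :=
    ⟨hum.indicator measurableSet_ball.compl, hvB.trans_lt ENNReal.ofReal_lt_top⟩
  have hlow := lintegral_weakLp_mul_kernel_le hf hp hA hR hK₁ hK₂ hdist (hK hR).1 (hK hR).2
  rw [← hC₀] at hlow
  have hdecomp := ae_eq_low_add_high hR hfh hh (locallyIntegrable_of_meas_le hf hp hA hdist)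
    (C := Real.toNNReal (C₀ * (A * R ^ (d / p)))) hlow hw hv
    (.of_forall fun ξ => hH ▸ congrFun (Set.indicator_self_add_compl _ _) ξ)
  refine ⟨(𝓕 hv.toLp : Lp ℂ 2 (volume : Measure (Eu d))), Lp.aestronglyMeasurable _, ?_, ?_⟩
  · rwa [eLpNorm_fourier_eq, eLpNorm_congr_ae hv.coeFn_toLp]
  have hP0 : 0 < A * R ^ (d / p) := by positivity
  have hQ0 : 0 < B * L ^ y * R ^ ((d : ℝ) / 2 - s) := by positivity
  generalize A * R ^ (d / p) = P at *
  generalize B * L ^ y * R ^ ((d : ℝ) / 2 - s) = Q at *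
  filter_upwards [hdecomp] with x hx
  have h1 : ‖∫ z, f z * lowKernel d hR (z - x)‖ ≤ C₀ * P := by
    have := (enorm_integral_le_lintegral_enorm fun z => f z * lowKernel d hR (z - x)).trans
      (by simpa only [enorm_mul] using hlow x)
    rwa [← ofReal_norm, ENNReal.ofReal_le_ofReal_iff (by positivity)] at this
  have h2 := (enorm_fourier_le_lintegral_enorm _ x).trans hwB
  rw [← ofReal_norm, ENNReal.ofReal_le_ofReal_iff (by positivity)] at h2
  rw [hx]
  refine norm_add₃_le.trans (add_le_add_left ((add_le_add h1 h2).trans ?_) _)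
  nlinarith [mul_nonneg hC₀0 hQ0.le, mul_nonneg hC' hP0.le]

/-- Distribution function of `f` at high levels, in terms of the frequency scales `R` and
`R * L`. -/
theorem exists_meas_lt_norm_le {p s y : ℝ} (hp : 1 < p) (hs : 0 < s) (hy : 0 ≤ y)
    (hsy : (d : ℝ) < 2 * (s + y)) :
    ∃ C : ℝ, 0 < C ∧ ∀ {f h : Eu d → ℂ} {A B : ℝ}, 0 < A → 0 < B → AEStronglyMeasurable f →
      (∀ t, 0 < t → volume {x | t < ‖f x‖} ≤ ENNReal.ofReal ((A / t) ^ p)) →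
      MemLp h 2 → eLpNorm h 2 ≤ ENNReal.ofReal B → IsFracLaplacian s f h →
      ∀ {R L t : ℝ}, 0 < R → 0 < L → 0 < t →
        C * (A * R ^ (d / p) + B * L ^ y * R ^ ((d : ℝ) / 2 - s)) ≤ t →
        volume {x | t < ‖f x‖} ≤ ENNReal.ofReal (4 * ((R * L) ^ (-s) * B / t) ^ 2) := by
  obtain ⟨C, hC, hbound⟩ := exists_norm_le_add_norm (d := d) hp hs hy hsy
  -- Doubling makes the bounded part at most `t / 2`, so `t < ‖f x‖` forces `‖V x‖ ≥ t / 2` and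
  -- Chebyshev's inequality applies to `V`.
  refine ⟨2 * C, by positivity, ?_⟩
  intro f h A B hA hB hf hdist hh hhB hfh R L t hR hL ht hlarge
  obtain ⟨V, hV, hVB, hfV⟩ := hbound hA hB hf hdist hh hhB hfh hR hL
  have hsub : {x | t < ‖f x‖} ≤ᵐ[volume] {x | ENNReal.ofReal (t / 2) ≤ ‖V x‖ₑ} := by
    filter_upwards [hfV] with x hx hxt
    change t < ‖f x‖ at hxt
    change ENNReal.ofReal (t / 2) ≤ ‖V x‖ₑ
    rw [← ofReal_norm]
    exact ENNReal.ofReal_le_ofReal (by linarith)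
  have ht2 : ENNReal.ofReal (t / 2) ≠ 0 := by simpa using ht
  calc volume {x | t < ‖f x‖} ≤ volume {x | ENNReal.ofReal (t / 2) ≤ ‖V x‖ₑ} :=
        measure_mono_ae hsub
    _ ≤ ENNReal.ofReal (t / 2)⁻¹ ^ (2 : ℝ) * ENNReal.ofReal ((R * L) ^ (-s) * B) ^ (2 : ℝ) := by
        have h1 := meas_ge_le_mul_pow_eLpNorm_enorm volume two_ne_zero ENNReal.ofNat_ne_top hV ht2
          fun h => absurd h ENNReal.ofReal_ne_top
        rw [ENNReal.toReal_ofNat, ← ENNReal.ofReal_inv_of_pos (half_pos ht)] at h1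
        exact h1.trans (mul_le_mul' le_rfl (ENNReal.rpow_le_rpow hVB zero_le_two))
    _ = _ := by
        rw [ENNReal.ofReal_rpow_of_nonneg (by positivity) (by norm_num),
          ENNReal.ofReal_rpow_of_nonneg (by positivity) (by norm_num),
          ← ENNReal.ofReal_mul (by positivity), Real.rpow_two, Real.rpow_two]
        congr 1
        field_simp
        ring

end DistributionEstimate

/-! ### The Gagliardo–Nirenberg inequality. -/

/-- Gagliardo–Nirenberg inequality with a weak Lebesgue endpoint, for positive bounds. -/
theorem exists_eLpNorm_le_of_pos {d : ℕ} (hd : 0 < d) {p q s : ℝ} (hp : 1 < p) (hpq : p < q)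
    (hs : 0 < s) (hq : (d : ℝ) / 2 - s < d / q) :
    ∃ C : ℝ, 0 ≤ C ∧ ∀ {f h : Eu d → ℂ} {A B : ℝ}, 0 < A → 0 < B → AEStronglyMeasurable f →
      (∀ t, 0 < t → volume {x | t < ‖f x‖} ≤ ENNReal.ofReal ((A / t) ^ p)) →
      MemLp h 2 → eLpNorm h 2 ≤ ENNReal.ofReal B → IsFracLaplacian s f h →
      eLpNorm f (ENNReal.ofReal q) ≤
        ENNReal.ofReal (C * (A ^ (1 - (d / p - d / q) / (d / p - (d / 2 - s))) *
          B ^ ((d / p - d / q) / (d / p - (d / 2 - s))))) := by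
  have hd' : (0 : ℝ) < d := by exact_mod_cast hd
  have hp0 : 0 < p := by linarith
  have hq0 : 0 < q := by linarith
  have hy : 0 < (d : ℝ) / q := by positivity
  have hqp : (d : ℝ) / q < d / p := div_lt_div_of_pos_left hd' hp0 hpq
  -- The exponent of `L` is taken to be `d / q`; the condition `s + y > d/2` is then the hypothesis
  -- `hq`.
  obtain ⟨y, hy_def⟩ : ∃ y : ℝ, y = d / q := ⟨_, rfl⟩
  obtain ⟨D, hD⟩ : ∃ D : ℝ, D = d / p := ⟨_, rfl⟩
  rw [← hy_def] at hy hq hqp ⊢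
  rw [← hD] at hqp ⊢
  have hdq : (d : ℝ) = y * q := by rw [hy_def]; field_simp
  have hdp : (d : ℝ) = D * p := by rw [hD]; field_simp
  obtain ⟨C, hC, hlarge⟩ := exists_meas_lt_norm_le (d := d) hp hs hy.le (by linarith)
  obtain ⟨M, hM_def⟩ : ∃ M : ℝ, M = D - (d / 2 - s) := ⟨_, rfl⟩
  have hM : 0 < M := by linarith
  rw [← hM_def]
  -- With `L^y` proportional to `t`, Chebyshev's `t^{-2}` gains `L^{-2s} ~ t^{-2s/y}`. As `y = d/q`,
  -- the inequality `b > q` is again `d/2 - s < d/q`.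
  obtain ⟨b, hb_def⟩ : ∃ b : ℝ, b = 2 + 2 * s / y := ⟨_, rfl⟩
  have hqb : q < b := by
    rw [hb_def, ← sub_lt_iff_lt_add', lt_div_iff₀ hy]
    nlinarith
  -- The sum of the constants of the high-level and the low-level bound, so that a single `K` serves
  -- both.
  obtain ⟨k, hk_def⟩ : ∃ k : ℝ, k = (C ^ 2)⁻¹ + (2 * C) ^ (-p) := ⟨_, rfl⟩
  have hk : 0 < k := by rw [hk_def]; positivity
  obtain ⟨c, hc_def⟩ : ∃ c : ℝ, c = q * (1 / (q - p) + 1 / (b - q)) := ⟨_, rfl⟩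
  have hc : 0 < c := by
    have h1 : 0 < q - p := by linarith
    have h2 : 0 < b - q := by linarith
    rw [hc_def]
    positivity
  refine ⟨(c * k) ^ (1 / q) * (2 * C), by positivity, ?_⟩
  intro f h A B hA hB hf hdist hh hhB hfh
  -- The scale at which `A R^D = B R^{d/2-s}`.
  obtain ⟨R, hR_def⟩ : ∃ R : ℝ, R = (B / A) ^ (1 / M) := ⟨_, rfl⟩
  have hR : 0 < R := by rw [hR_def]; positivity
  have hRM : ∀ z : ℝ, R ^ z = (B / A) ^ (z / M) := fun z => by
    rw [hR_def, ← Real.rpow_mul (by positivity)]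
    congr 1
    ring
  obtain ⟨N, hN_def⟩ : ∃ N : ℝ, N = A * R ^ D := ⟨_, rfl⟩
  have hN : 0 < N := by rw [hN_def]; positivity
  have hBN : B = N * R ^ (s - (d : ℝ) / 2) := by
    rw [hN_def, mul_assoc, ← Real.rpow_add hR, show D + (s - (d : ℝ) / 2) = M by rw [hM_def]; ring,
      hRM, div_self hM.ne', Real.rpow_one]
    field_simp
  have hRd : 0 < R ^ (-(d : ℝ)) := by positivity
  have key := lintegral_rpow_le_of_meas_le (μ := volume) (u := fun x => ‖f x‖) (a := p) (b := b)
    (q := q) (K := k * R ^ (-(d : ℝ))) (N := 2 * C * N) (fun x => norm_nonneg _)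
    hf.norm.aemeasurable hq0 hpq hqb (by positivity) (by positivity) ?_ ?_
  · rw [← hc_def] at key
    rw [eLpNorm_eq_lintegral_rpow_enorm_toReal (by simpa using hq0) ENNReal.ofReal_ne_top,
      ENNReal.toReal_ofReal hq0.le]
    have hle : ∫⁻ x, ‖f x‖ₑ ^ q ≤
        ENNReal.ofReal (c * (k * R ^ (-(d : ℝ))) * (2 * C * N) ^ q) := by
      refine le_trans (le_of_eq (lintegral_congr fun x => ?_)) key
      rw [← ofReal_norm, ENNReal.ofReal_rpow_of_nonneg (norm_nonneg _) hq0.le]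
    refine (ENNReal.rpow_le_rpow hle (by positivity)).trans (le_of_eq ?_)
    rw [ENNReal.ofReal_rpow_of_nonneg (by positivity) (by positivity)]
    congr 1
    have hRy : (R ^ (-(d : ℝ))) ^ (1 / q) = R ^ (-y) := by
      rw [← Real.rpow_mul hR.le, hy_def]
      congr 1
      ring
    have hNq : ((2 * C * N) ^ q) ^ (1 / q) = 2 * C * N := by
      rw [← Real.rpow_mul (by positivity), mul_one_div_cancel hq0.ne', Real.rpow_one]
    rw [← mul_assoc, Real.mul_rpow (by positivity) (by positivity),
      Real.mul_rpow (by positivity) (by positivity), hRy, hNq, hN_def]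
    have hfin : R ^ (-y) * R ^ D * A = A ^ (1 - (D - y) / M) * B ^ ((D - y) / M) := by
      rw [← Real.rpow_add hR, hRM, Real.div_rpow hB.le hA.le, Real.rpow_sub hA, Real.rpow_one,
        show -y + D = D - y by ring]
      field_simp
    rw [← hfin]
    ring
  · intro t ht _
    refine (hdist t ht).trans (ENNReal.ofReal_le_ofReal ?_)
    have h1 : (A / t) ^ p = (2 * C) ^ (-p) * R ^ (-(d : ℝ)) * (t / (2 * C * N)) ^ (-p) := by
      rw [hdp, ← neg_mul, Real.rpow_mul hR.le, Real.rpow_neg (by positivity : 0 ≤ t / (2 * C * N)),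
        Real.rpow_neg (by positivity : 0 ≤ 2 * C), ← Real.inv_rpow (by positivity),
        ← Real.inv_rpow (by positivity),
        Real.rpow_neg hR.le, ← Real.mul_rpow (by positivity) (by positivity),
        ← Real.mul_rpow (by positivity) (by positivity), hN_def]
      congr 1
      field_simp
    rw [h1]
    gcongr
    rw [hk_def]
    have : 0 < (C ^ 2)⁻¹ := by positivity
    linarith
  · intro t ht
    have hN1 : 0 < 2 * C * N := by positivity
    have ht0 : 0 < t := hN1.trans ht
    obtain ⟨τ, hτ_def⟩ : ∃ τ : ℝ, τ = t / (2 * C * N) := ⟨_, rfl⟩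
    have htτ : t = 2 * C * N * τ := by rw [hτ_def]; field_simp
    have hτ : 1 < τ := by rw [hτ_def]; exact (one_lt_div hN1).2 ht
    have hτ0 : 0 < τ := by linarith
    rw [← hτ_def]
    -- With `L = τ^{1/y}` the bounded parts sum to `C (N + N τ)`, which is at most `2 C N τ = t`
    -- because `τ > 1`.
    have hL : (0 : ℝ) < τ ^ (1 / y) := by positivity
    have hLy : (τ ^ (1 / y)) ^ y = τ := by
      rw [← Real.rpow_mul hτ0.le, one_div_mul_cancel hy.ne', Real.rpow_one]
    refine (hlarge hA hB hf hdist hh hhB hfh hR hL ht0 ?_).trans (ENNReal.ofReal_le_ofReal ?_)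
    · have h1 : B * τ * R ^ ((d : ℝ) / 2 - s) = N * τ := by
        rw [hBN, show s - (d : ℝ) / 2 = -((d : ℝ) / 2 - s) by ring, Real.rpow_neg hR.le]
        have : 0 < R ^ ((d : ℝ) / 2 - s) := by positivity
        field_simp
      rw [hLy, h1, ← hD, ← hN_def, htτ]
      nlinarith [mul_pos hC hN, mul_lt_mul_of_pos_left hτ (mul_pos hC hN)]
    · have h1 : 4 * ((R * τ ^ (1 / y)) ^ (-s) * B / t) ^ 2 =
          (C ^ 2)⁻¹ * R ^ (-(d : ℝ)) * τ ^ (-b) := by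
        have e1 : (R * τ ^ (1 / y)) ^ (-s) * B = N * R ^ (-(d : ℝ) / 2) * τ ^ (-(s / y)) := by
          rw [Real.mul_rpow hR.le hL.le, ← Real.rpow_mul hτ0.le, hBN,
            show -(d : ℝ) / 2 = -s + (s - d / 2) by ring, Real.rpow_add hR,
            show 1 / y * -s = -(s / y) by ring]
          ring
        have e2 : R ^ (-(d : ℝ)) = (R ^ (-(d : ℝ) / 2)) ^ 2 := by
          rw [← Real.rpow_mul_natCast hR.le]
          congr 1
          push_cast
          ring
        have e3 : τ ^ (-b) = (τ ^ (-(s / y))) ^ 2 * (τ ^ 2)⁻¹ := by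
          rw [← Real.rpow_mul_natCast hτ0.le, ← Real.rpow_two, ← Real.rpow_neg hτ0.le,
            ← Real.rpow_add hτ0, hb_def]
          congr 1
          push_cast
          ring
        rw [e1, e2, e3, htτ]
        field_simp
        ring
      rw [h1]
      gcongr
      rw [hk_def]
      have : 0 < (2 * C) ^ (-p) := by positivity
      linarith

/-- If `c'` is below the distribution function at `t`, no level under `t` is admissible in the
infimum defining `f*(c')`. Hence `f*(c') ≥ t` and `c'^{1/p} t` is at most the weak norm. -/
lemma meas_lt_norm_le_of_weakLpNorm {d : ℕ} {p : ℝ} (hp : 0 < p) (f : Eu d → ℂ) {t : ℝ}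
    (ht : 0 < t) :
    volume {x | t < ‖f x‖} ≤ (weakLpNorm p f / ENNReal.ofReal t) ^ p := by
  refine le_of_forall_lt fun c hc => ?_
  obtain ⟨c', hcc', hc'⟩ := exists_between hc
  refine hcc'.trans_le ?_
  have hc'top : c' ≠ ∞ := hc'.ne_top
  have hc'0 : 0 < c'.toReal := ENNReal.toReal_pos (pos_of_gt hcc').ne' hc'top
  have hstar : ENNReal.ofReal t ≤ decRearrangement f c'.toReal := by
    refine le_iInf fun σ => le_iInf fun _ => le_iInf fun hσ => ?_
    rw [ENNReal.ofReal_toReal hc'top] at hσ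
    rw [← ENNReal.ofReal_coe_nnreal]
    refine ENNReal.ofReal_le_ofReal (le_of_not_gt fun h => ?_)
    refine (hc'.trans_le (measure_mono fun x hx => ?_)).not_ge hσ
    exact h.trans hx
  have hW : c' ^ (1 / p) * ENNReal.ofReal t ≤ weakLpNorm p f := by
    refine le_trans ?_ (le_iSup₂_of_le (f := fun (t : ℝ) (_ : 0 < t) =>
      ENNReal.ofReal t ^ (1 / p) * decRearrangement f t) c'.toReal hc'0 le_rfl)
    rw [ENNReal.ofReal_toReal hc'top]
    gcongr
  have h1 : c' ^ (1 / p) ≤ weakLpNorm p f / ENNReal.ofReal t :=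
    (ENNReal.le_div_iff_mul_le (Or.inl (by simpa using ht)) (Or.inl ENNReal.ofReal_ne_top)).2 hW
  calc c' = (c' ^ (1 / p)) ^ p := by
        rw [← ENNReal.rpow_mul, one_div_mul_cancel hp.ne', ENNReal.rpow_one]
    _ ≤ _ := ENNReal.rpow_le_rpow h1 hp.le

lemma meas_lt_norm_le_of_eLpNorm_two {d : ℕ} {g : Eu d → ℂ} (hg : AEStronglyMeasurable g) {t : ℝ}
    (ht : 0 < t) :
    volume {x | t < ‖g x‖} ≤ (eLpNorm g 2 / ENNReal.ofReal t) ^ (2 : ℝ) := by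
  have h1 := meas_ge_le_mul_pow_eLpNorm_enorm volume two_ne_zero ENNReal.ofNat_ne_top hg
    (ε := ENNReal.ofReal t) (by simpa using ht) fun h => absurd h ENNReal.ofReal_ne_top
  rw [ENNReal.toReal_ofNat, ← ENNReal.mul_rpow_of_nonneg _ _ zero_le_two, mul_comm,
    ← div_eq_mul_inv] at h1
  refine (measure_mono fun x hx => ?_).trans h1
  change ENNReal.ofReal t ≤ ‖g x‖ₑ
  rw [← ofReal_norm]
  exact ENNReal.ofReal_le_ofReal (le_of_lt hx)

/-- Gagliardo–Nirenberg inequality with a weak Lebesgue endpoint. -/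
theorem exists_eLpNorm_le_rpow_mul_homSobolevNorm {d : ℕ} (hd : 0 < d) {p q s : ℝ} (hp : 1 < p)
    (hpq : p < q) (hs : 0 < s) (hq : (d : ℝ) / 2 - s < d / q) {θ : ℝ} (hθ₀ : 0 ≤ θ) (hθ₁ : θ ≤ 1)
    (hθ : θ = (d / p - d / q) / (d / p - (d / 2 - s))) :
    ∃ C : ℝ≥0, ∀ {f : Eu d → ℂ} {a : ℝ≥0∞}, AEStronglyMeasurable f → a ≠ ∞ →
      (∀ t, 0 < t → volume {x | t < ‖f x‖} ≤ (a / ENNReal.ofReal t) ^ p) →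
      homSobolevNorm s f ≠ ∞ →
      eLpNorm f (ENNReal.ofReal q) ≤ C * (a ^ (1 - θ) * homSobolevNorm s f ^ θ) := by
  obtain ⟨C, hC, hbound⟩ := exists_eLpNorm_le_of_pos hd hp hpq hs hq
  rw [← hθ] at hbound
  refine ⟨C.toNNReal, fun {f a} hf ha hdist hb => ?_⟩
  obtain ⟨b, hb_def⟩ : ∃ b, b = homSobolevNorm s f := ⟨_, rfl⟩
  rw [← hb_def] at hb ⊢
  -- Enlarging by `ε` makes both bounds positive and supplies an `h` nearly attaining the infimum in
  -- `homSobolevNorm`; then `ε → 0`.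
  have hpos : ∀ ε : ℝ, 0 < ε → eLpNorm f (ENNReal.ofReal q) ≤
      ENNReal.ofReal (C * ((a.toReal + ε) ^ (1 - θ) * (b.toReal + ε) ^ θ)) := by
    intro ε hε
    have hA : 0 < a.toReal + ε := by positivity
    have hB : 0 < b.toReal + ε := by positivity
    have haA : a ≤ ENNReal.ofReal (a.toReal + ε) := by
      refine (ENNReal.ofReal_toReal ha).symm.trans_le (ENNReal.ofReal_le_ofReal ?_)
      linarith
    have hbB : homSobolevNorm s f < ENNReal.ofReal (b.toReal + ε) := by
      rw [← hb_def]
      refine (ENNReal.ofReal_toReal hb).symm.trans_lt ((ENNReal.ofReal_lt_ofReal_iff hB).2 ?_)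
      linarith
    simp only [homSobolevNorm, iInf_lt_iff] at hbB
    obtain ⟨h, hh, hfh, hhB⟩ := hbB
    refine hbound hA hB hf (fun t ht => (hdist t ht).trans ?_) hh hhB.le hfh
    rw [← ENNReal.ofReal_rpow_of_nonneg (by positivity) (by linarith),
      ENNReal.ofReal_div_of_pos ht]
    gcongr
  have hcont : Filter.Tendsto
      (fun ε : ℝ => ENNReal.ofReal (C * ((a.toReal + ε) ^ (1 - θ) * (b.toReal + ε) ^ θ)))
      (nhdsWithin 0 (Set.Ioi 0))
      (nhds (ENNReal.ofReal (C * ((a.toReal + 0) ^ (1 - θ) * (b.toReal + 0) ^ θ)))) := by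
    refine (Continuous.tendsto ?_ 0).mono_left nhdsWithin_le_nhds
    refine ENNReal.continuous_ofReal.comp (continuous_const.mul (Continuous.mul ?_ ?_))
    · exact (Real.continuous_rpow_const (by linarith)).comp (by fun_prop)
    · exact (Real.continuous_rpow_const hθ₀).comp (by fun_prop)
  refine (ge_of_tendsto hcont (by
    filter_upwards [self_mem_nhdsWithin] with ε hε using hpos ε hε)).trans (le_of_eq ?_)
  rw [add_zero, add_zero, ENNReal.ofReal_mul hC, ENNReal.ofReal_mul (by positivity),
    ← ENNReal.ofReal_rpow_of_nonneg (by positivity) (by linarith),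
    ← ENNReal.ofReal_rpow_of_nonneg (by positivity) hθ₀, ENNReal.ofReal_toReal ha,
    ENNReal.ofReal_toReal hb]
  rfl

/-! ### The product estimate and the choice of exponents. -/

/-- Functions in `H^s`, `s ≥ 0`, are square integrable. -/
lemma MemInhomSobolev.memLp_two {d : ℕ} {s : ℝ} (hs : 0 ≤ s) {g : Eu d → ℂ}
    (hg : MemInhomSobolev s g) : MemLp g 2 := by
  obtain ⟨-, u, hu, hug⟩ := hg
  obtain ⟨v, hv⟩ := TemperedDistribution.memSobolev_zero_iff.1 (hu.mono hs)
  have hloc : LocallyIntegrable g := by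
    intro x
    let χ : ContDiffBump x := ⟨1, 2, one_pos, one_lt_two⟩
    let φ : 𝓢(Eu d, ℂ) := HasCompactSupport.toSchwartzMap (f := fun y => (χ y : ℂ))
      (χ.hasCompactSupport.comp_left Complex.ofReal_zero)
      (Complex.ofRealCLM.contDiff.comp χ.contDiff)
    refine ⟨Metric.closedBall x 1, Metric.closedBall_mem_nhds x one_pos, ?_⟩
    refine ((hug φ).1.integrableOn (s := Metric.closedBall x 1)).congr_fun (fun y hy => ?_)
      measurableSet_closedBall
    have : φ y = (χ y : ℂ) := rfl
    simp only [this, χ.one_of_mem_closedBall hy, Complex.ofReal_one, one_mul]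
  have hgv : ∀ᵐ x, g x = v x := by
    refine ae_eq_of_integral_contDiff_smul_eq hloc
      ((Lp.memLp v).locallyIntegrable (by norm_num)) fun χ hχ hχs => ?_
    let φ : 𝓢(Eu d, ℂ) := HasCompactSupport.toSchwartzMap (f := fun y => (χ y : ℂ))
      (hχs.comp_left Complex.ofReal_zero) (Complex.ofRealCLM.contDiff.comp hχ)
    have h1 := (hug φ).2
    rw [hv, Lp.toTemperedDistribution_apply] at h1
    simpa only [Complex.real_smul] using! h1.symm
  exact (memLp_congr_ae hgv).2 (Lp.memLp v)

/-- The product estimate, with `x = d / q` the scaling dimension of the intermediate space. -/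
theorem productEstimate_of_scaling {d : ℕ} {α β x : ℝ} (hα : 1 / 2 < α)
    (hβ : 0 < β) (hx₀ : 0 < x) (hxα : (d : ℝ) / 2 - α < x)
    (hxd : x < d / 2) (hxD : x < d + 1 - 2 * α) (hxβ : x < β) :
    (d + 1 - 2 * α - x) / ((d : ℝ) / 2 + 1 - α) ∈ Set.Ioo (0 : ℝ) 1 ∧
    x / β ∈ Set.Ioo (0 : ℝ) 1 ∧
    ProductEstimate d α β ((d + 1 - 2 * α - x) / ((d : ℝ) / 2 + 1 - α)) (x / β) := by
  have hd' : (0 : ℝ) < d := by linarith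
  have hd : 0 < d := by exact_mod_cast hd'
  have hM : 0 < (d : ℝ) / 2 + 1 - α := by linarith
  have hD : 0 < (d : ℝ) + 1 - 2 * α := by linarith
  have hθ₁ : (d + 1 - 2 * α - x) / ((d : ℝ) / 2 + 1 - α) ∈ Set.Ioo (0 : ℝ) 1 :=
    ⟨by apply div_pos <;> linarith, by rw [div_lt_one hM]; linarith⟩
  have hθ₂ : x / β ∈ Set.Ioo (0 : ℝ) 1 := ⟨by positivity, (div_lt_one hβ).2 hxβ⟩
  refine ⟨hθ₁, hθ₂, ?_⟩
  obtain ⟨p, hp_def⟩ : ∃ p : ℝ, p = d / (d + 1 - 2 * α) := ⟨_, rfl⟩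
  have hdp : d / p = (d : ℝ) + 1 - 2 * α := by rw [hp_def]; field_simp
  have hp : 1 < p := by rw [hp_def, one_lt_div hD]; linarith
  obtain ⟨q, hq_def⟩ : ∃ q : ℝ, q = d / x := ⟨_, rfl⟩
  have hdq : d / q = x := by rw [hq_def]; field_simp
  have hpq : p < q := by rw [hp_def, hq_def]; exact div_lt_div_of_pos_left hd' hx₀ hxD
  have hr0 : 0 < (d : ℝ) / 2 - x := by linarith
  obtain ⟨r, hr_def⟩ : ∃ r : ℝ, r = d / (d / 2 - x) := ⟨_, rfl⟩
  have hdr : d / r = (d : ℝ) / 2 - x := by rw [hr_def]; field_simp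
  have hr : 2 < r := by rw [hr_def, lt_div_iff₀ hr0]; linarith
  have hq0 : 0 < q := by linarith
  obtain ⟨C₁, hC₁⟩ := exists_eLpNorm_le_rpow_mul_homSobolevNorm (s := α) hd hp hpq (by linarith)
    (by rw [hdq]; exact hxα) hθ₁.1.le hθ₁.2.le
    (by rw [hdp, hdq]; congr 1; ring)
  obtain ⟨C₂, hC₂⟩ := exists_eLpNorm_le_rpow_mul_homSobolevNorm hd one_lt_two hr hβ
    (by rw [hdr]; linarith) hθ₂.1.le hθ₂.2.le (by rw [hdr]; congr 1 <;> ring)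
  generalize (d + 1 - 2 * α - x) / ((d : ℝ) / 2 + 1 - α) = θ₁ at *
  generalize x / β = θ₂ at *
  have hholder : ENNReal.HolderTriple (ENNReal.ofReal q) (ENNReal.ofReal r) 2 := ⟨by
    rw [← ENNReal.ofReal_inv_of_pos hq0, ← ENNReal.ofReal_inv_of_pos (by linarith),
      ← ENNReal.ofReal_add (by positivity) (by positivity), ← ENNReal.ofReal_ofNat,
      ← ENNReal.ofReal_inv_of_pos two_pos]
    congr 1
    rw [hq_def, hr_def]
    field_simp
    ring⟩
  -- The `+ 1` keeps the constant nonzero: if `homSobolevNorm β g = ∞` and `g` is not null, the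
  -- factor for `g` on the right is then `∞`.
  refine ⟨C₁ * (C₂ + 1), fun f g hf hfα hg => ?_⟩
  rw [← hp_def] at hf ⊢
  have hg2 := hg.memLp_two hβ.le
  have hfb : homSobolevNorm α f ≠ ∞ := by
    obtain ⟨h, hh, hfh⟩ := hfα
    have : homSobolevNorm α f ≤ eLpNorm h 2 := iInf_le_of_le h (iInf₂_le hh hfh)
    exact (this.trans_lt hh.2).ne
  have hprod : eLpNorm (fun x => f x * g x) 2 ≤
      eLpNorm f (ENNReal.ofReal q) * eLpNorm g (ENNReal.ofReal r) :=
    eLpNorm_smul_le_mul_eLpNorm (f := g) (φ := f) hg.1 hf.1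
  have hfq := hC₁ hf.1 hf.2.ne
    (fun t ht => meas_lt_norm_le_of_weakLpNorm (by linarith) f ht) hfb
  have hgoal : eLpNorm (fun x => f x * g x) 2 ≤
      (C₁ * (weakLpNorm p f ^ (1 - θ₁) * homSobolevNorm α f ^ θ₁)) *
        ((C₂ + 1 : ℝ≥0) * (eLpNorm g 2 ^ (1 - θ₂) * homSobolevNorm β g ^ θ₂)) := by
    by_cases hgb : homSobolevNorm β g = ∞
    · rcases eq_or_ne (eLpNorm g 2) 0 with hg0 | hg0
      · have : eLpNorm (fun x => f x * g x) 2 = 0 := by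
          refine (eLpNorm_eq_zero_iff (hf.1.mul hg.1) two_ne_zero).2 ?_
          filter_upwards [(eLpNorm_eq_zero_iff hg.1 two_ne_zero).1 hg0] with x hx
          rw [Pi.mul_apply, hx, Pi.zero_apply, mul_zero]
        rw [this]
        exact zero_le
      · rw [hgb, ENNReal.top_rpow_of_pos hθ₂.1, ENNReal.mul_top, ENNReal.mul_top]
        · exact hprod.trans (mul_le_mul' hfq le_top)
        · simp
        · simp [ENNReal.rpow_eq_zero_iff, hg0, hg2.2.ne]
    · refine hprod.trans (mul_le_mul' hfq ?_)
      refine (hC₂ hg.1 hg2.2.ne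
        (fun t ht => meas_lt_norm_le_of_eLpNorm_two hg.1 ht) hgb).trans ?_
      gcongr
      exact le_self_add
  refine hgoal.trans (le_of_eq ?_)
  rw [ENNReal.coe_mul]
  ring

theorem mainTheorem3 (d : ℕ) (α β : ℝ) (hα₁ : 1 / 2 < α) (hα₂ : α < ((d : ℝ) + 1) / 2)
    (hβ : 0 < β) (hαβ : (d : ℝ) / 2 < α + β) :
    (∃ θ₁ ∈ Set.Ioo (0 : ℝ) 1, ∃ θ₂ ∈ Set.Ioo (0 : ℝ) 1, ProductEstimate d α β θ₁ θ₂) ∧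
    (∀ μ ∈ Set.Icc (0 : ℝ) 1, (d : ℝ) / 2 + 1 ≤ α + (1 - μ) * β →
      ∃ θ₁ ∈ Set.Ioo (0 : ℝ) 1, ∃ θ₂ ∈ Set.Ioo (0 : ℝ) 1,
        ProductEstimate d α β θ₁ θ₂ ∧ (1 + μ) * θ₁ + θ₂ + 1 / β ≤ 2) := by
  have hM : 1 / 2 < (d : ℝ) / 2 + 1 - α := by linarith
  refine ⟨?_, fun μ hμ hμβ => ?_⟩
  -- The interval of admissible `x` is nonempty: `d/2 - α < β` is the hypothesis on `α + β`, and the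
  -- remaining comparisons follow from `1/2 < α < (d+1)/2` and `β > 0`.
  · obtain ⟨x, hx₁, hx₂⟩ : ∃ x, max 0 ((d : ℝ) / 2 - α) < x ∧
        x < min ((d : ℝ) / 2) (min (d + 1 - 2 * α) β) := by
      refine exists_between (max_lt (lt_min ?_ (lt_min ?_ ?_)) (lt_min ?_ (lt_min ?_ ?_))) <;>
        linarith
    rw [max_lt_iff] at hx₁
    rw [lt_min_iff, lt_min_iff] at hx₂
    obtain ⟨h₁, h₂, h₃⟩ :=
      productEstimate_of_scaling hα₁ hβ hx₁.1 hx₁.2 hx₂.1 hx₂.2.1 hx₂.2.2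
    exact ⟨_, h₁, _, h₂, h₃⟩
  · have hμβ' : (d : ℝ) / 2 + 1 - α ≤ (1 - μ) * β := by linarith
    have hMβ : (d : ℝ) / 2 + 1 - α ≤ β := by nlinarith [hμ.1]
    -- Half of `d + 1 - 2α`. With `M = d/2 + 1 - α` and `M ≤ (1-μ)β`, the left side of the
    -- constraint is at most `2 + 2μ(M - 1 - x)/M`; this choice has `x = M - 1/2` and leaves slack
    -- `μ/M`.
    obtain ⟨h₁, h₂, h₃⟩ := productEstimate_of_scaling (d := d) (x := ((d : ℝ) + 1) / 2 - α) hα₁ hβ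
      (by linarith) (by linarith) (by linarith) (by linarith) (by linarith)
    refine ⟨_, h₁, _, h₂, h₃, ?_⟩
    obtain ⟨M, hM_def⟩ : ∃ M : ℝ, M = (d : ℝ) / 2 + 1 - α := ⟨_, rfl⟩
    rw [show (d : ℝ) + 1 - 2 * α - (((d : ℝ) + 1) / 2 - α) = M - 1 / 2 by rw [hM_def]; ring,
      show ((d : ℝ) + 1) / 2 - α = M - 1 / 2 by rw [hM_def]; ring, ← hM_def]
    rw [← hM_def] at hM hμβ'
    have hM0 : 0 < M := by linarith
    have h4 : (M + 1 / 2) / β ≤ (1 - μ) * ((M + 1 / 2) / M) := by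
      rw [← mul_div_assoc, div_le_div_iff₀ hβ hM0]
      nlinarith
    have h5 : (1 + μ) * ((M - 1 / 2) / M) + (1 - μ) * ((M + 1 / 2) / M) = 2 - μ / M := by
      field_simp
      ring
    have h6 : 0 ≤ μ / M := div_nonneg hμ.1 hM0.le
    have h7 : (M - 1 / 2) / β + 1 / β = (M + 1 / 2) / β := by
      field_simp
      ring
    linarith
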